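/- Let $n\ge 1$. For $\alpha_0,\dots,\alpha_{n-2}$ in the open unit disk and $\alpha_{n-1}$ on the unit circle put $\rho_k=\sqrt{1-|\alpha_k|^2}$, $\Xi_k=\begin{bmatrix}\bar\alpha_k&\rho_k\\ \rho_k&-\alpha_k\end{bmatrix}$ for $0\le k\le n-2$, and let $\Xi_{-1}=[1]$, $\Xi_{n-1}=[\bar\alpha_{n-1}]$ be $1\times1$. The associated CMV matrix is the $n\times n$ matrix $\mathcal C=\operatorname{diag}(\Xi_0,\Xi_2,\dots)\operatorname{diag}(\Xi_{-1},\Xi_1,\dots)$. Let $\mathfrak g$ be the real vector space of complex $n\times n$ matrices. Write $\mathfrak g=\mathfrak l\oplus\mathfrak a$, with $\mathfrak a$ the anti-Hermitian matrices and $\mathfrak l$ the lower triangular matrices with real diagonal, let $R=\pi_{\mathfrak l}-\pi_{\mathfrak a}$, $\langle X,Y\rangle=\operatorname{Im}\operatorname{tr}(XY)$, and define $\nabla\phi$ by $\frac{d}{dt}\big|_{t=0}\phi(B+tV)=\langle\nabla\phi|_B,V\rangle$. The Gelfand--Dikij bracket is $$\{\phi,\psi\}(B)=\tfrac12\langle R(XB),YB\rangle-\tfrac12\langle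 R(BX),BY\rangle,\qquad X=\nabla\phi|_B,\ Y=\nabla\psi|_B .$$ The bracket at a CMV matrix $\mathcal C$ of two functions given only on the CMV matrices near $\mathcal C$ is the common value at $\mathcal C$ of the brackets of all their smooth extensions to neighbourhoods of $\mathcal C$ in $\mathfrak g$; that such extensions exist, and that the value does not depend on them, is part of each bracket identity below. Let $f$ be a complex polynomial, $\phi(B)=\operatorname{Im}\operatorname{tr}f(B)$ and $F(z)=2\operatorname{Re}(zf'(z))$. Let $\mathcal C$ be an $n\times n$ CMV matrix. (a) The $n$ eigenvalues of CMV matrices near $\mathcal C$ are distinct and can be written $e^{i\theta_1},\dots,e^{i\theta_n}$ with $\theta=(\theta_1,\dots,\theta_n)$ a real function that is continuous at $\mathcal C$. For every such choice, let $\mu_j$ be the mass at $e^{i\theta_j}$ of the spectral measure of the CMV matrix and the vector $e_1$. Then at $\mathcal C$ $$\{\phi,\log\mu_j\}=F(e^{i\theta_j})-\sum_{l=1}^nF(e^{i\theta_l})\mu_l\quad(1\le j\le n),\qquad \{\theta_l,\tfrac12\log[\mu_j/\mu_n]\}=\delta_{jl}\quad(1\le j,l\le n-1).$$ (b) There is an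 integral curve $\mathcal C(t)$, $t\in\mathbb R$, with $\mathcal C(0)=\mathcal C$ of the Hamiltonian flow of $\phi$, that is, $\frac{d}{dt}\psi(\mathcal C(t))=\{\phi,\psi\}(\mathcal C(t))$ for every smooth $\psi:\mathfrak g\to\mathbb R$. For every such curve, all $\mathcal C(t)$ are CMV matrices with the same eigenvalues $e^{i\theta_1},\dots,e^{i\theta_n}$ as $\mathcal C$, and the masses $\mu_j(t)$ of the spectral measure of $(\mathcal C(t),e_1)$ at $e^{i\theta_j}$ are positive and satisfy, for all $t\in\mathbb R$ and $1\le j\le n$, $$\partial_t\log\mu_j(t)=F(e^{i\theta_j})-\sum_{l=1}^nF(e^{i\theta_l})\mu_l(t),\qquad \mu_j(t)=\frac{\exp[F(e^{i\theta_j})t]\,\mu_j(0)}{\sum_{l=1}^n\exp[F(e^{i\theta_l})t]\,\mu_l(0)} .$$ -/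

import Mathlib

open scoped ContDiff Topology
open Polynomial

/- The smooth structure on the real vector space of complex `n × n` matrices: the entrywise
sup norm. All norms on this finite-dimensional space give the same notions below. -/
attribute [local instance] Matrix.normedAddCommGroup Matrix.normedSpace

namespace CMV

noncomputable section

/-- The space `𝔤` of `n × n` complex matrices. -/
abbrev Mat (n : ℕ) : Type := Matrix (Fin n) (Fin n) ℂ

/-! ### CMV matrices -/

/-- The block `Ξ = [[conj a, ρ], [ρ, -a]]` with `ρ = √(1 - |a|²)`. -/
def xi (a : ℂ) : Matrix (Fin 2) (Fin 2) ℂ :=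
  !![star a, ((Real.sqrt (1 - ‖a‖ ^ 2) : ℝ) : ℂ);
     ((Real.sqrt (1 - ‖a‖ ^ 2) : ℝ) : ℂ), -a]

/-- `ℒ = diag(Ξ₀, Ξ₂, Ξ₄, …)`. With rows and columns numbered from `0`, the block `Ξ_k` occupies
the indices `k, k + 1`; if `n` is odd, the last block is the `1 × 1` block `[conj α_{n-1}]`,
the top left entry of `xi (α (n - 1))`. -/
def matL (n : ℕ) (α : ℕ → ℂ) : Mat n :=
  Matrix.of fun i j =>
    if (i : ℕ) / 2 = (j : ℕ) / 2 then
      xi (α (2 * ((i : ℕ) / 2))) (Fin.ofNat 2 (i : ℕ)) (Fin.ofNat 2 (j : ℕ))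
    else 0

/-- `ℳ = diag(Ξ₋₁, Ξ₁, Ξ₃, …)` with `Ξ₋₁ = [1]`; if `n` is even, the last block is the `1 × 1`
block `[conj α_{n-1}]`. -/
def matM (n : ℕ) (α : ℕ → ℂ) : Mat n :=
  Matrix.of fun i j =>
    if ((i : ℕ) + 1) / 2 = ((j : ℕ) + 1) / 2 then
      if (i : ℕ) = 0 then 1
      else xi (α (2 * (((i : ℕ) + 1) / 2) - 1))
        (Fin.ofNat 2 ((i : ℕ) + 1)) (Fin.ofNat 2 ((j : ℕ) + 1))
    else 0

/-- The CMV matrix `𝒞 = ℒℳ` with coefficients `α₀, …, α_{n-1}`; the values `α k` with `n ≤ k`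
play no role. -/
def cmvMatrix (n : ℕ) (α : ℕ → ℂ) : Mat n := matL n α * matM n α

/-- The set (manifold) of `n × n` CMV matrices: `α₀, …, α_{n-2}` in the open unit disk and
`α_{n-1}` on the unit circle. -/
def cmvSet (n : ℕ) : Set (Mat n) :=
  {C | ∃ α : ℕ → ℂ, (∀ k, k + 1 < n → ‖α k‖ < 1) ∧ ‖α (n - 1)‖ = 1 ∧ C = cmvMatrix n α}

/-! ### The Gelfand–Dikij bracket -/

/-- The projection of `𝔤 = 𝔩 ⊕ 𝔞` onto the anti-Hermitian matrices `𝔞` along `𝔩`, the lower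
triangular matrices with real diagonal. -/
def piA {n : ℕ} (X : Mat n) : Mat n :=
  Matrix.of fun i j =>
    if i < j then X i j
    else if i = j then Complex.I * ((X i i).im : ℂ)
    else -star (X j i)

/-- The projection of `𝔤 = 𝔩 ⊕ 𝔞` onto `𝔩` along `𝔞`. -/
def piL {n : ℕ} (X : Mat n) : Mat n := X - piA X

theorem piA_conjTranspose {n : ℕ} (X : Mat n) : (piA X).conjTranspose = -piA X := by
  ext i j
  rcases lt_trichotomy i j with h | h | h
  · simp [piA, h, h.not_gt, h.ne']
  · subst h; simp [piA]
  · simp [piA, h, h.not_gt, h.ne']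

theorem piL_apply_of_lt {n : ℕ} (X : Mat n) {i j : Fin n} (h : i < j) : piL X i j = 0 := by
  simp [piL, piA, h]

theorem piL_diag_im {n : ℕ} (X : Mat n) (i : Fin n) : (piL X i i).im = 0 := by
  simp [piL, piA]

/-- `R = π_𝔩 - π_𝔞`. -/
def rMap {n : ℕ} (X : Mat n) : Mat n := piL X - piA X

/-- The pairing `⟨X, Y⟩ = Im tr (XY)`. -/
def pairing {n : ℕ} (X Y : Mat n) : ℝ := (X * Y).trace.im

/-- The gradient with respect to the pairing:
`[∇φ]_{kl} = ∂φ/∂v_{lk} + i ∂φ/∂u_{lk}`, where `u + iv` are the matrix entries. -/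
def grad {n : ℕ} (φ : Mat n → ℝ) (B : Mat n) : Mat n :=
  Matrix.of fun k l =>
    ((fderiv ℝ φ B (Matrix.single l k Complex.I) : ℝ) : ℂ)
      + Complex.I * ((fderiv ℝ φ B (Matrix.single l k 1) : ℝ) : ℂ)

theorem pairing_grad {n : ℕ} (φ : Mat n → ℝ) (B V : Mat n) :
    pairing (grad φ B) V = fderiv ℝ φ B V := by
  have hV : V = ∑ l, ∑ k, ((V l k).re • Matrix.single l k (1 : ℂ)
      + (V l k).im • Matrix.single l k Complex.I) := by
    conv_lhs => rw [Matrix.matrix_eq_sum_single V]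
    refine Finset.sum_congr rfl fun l _ => Finset.sum_congr rfl fun k _ => ?_
    rw [Matrix.smul_single, Matrix.smul_single, ← Matrix.single_add]
    congr 1
    simp [Complex.re_add_im]
  conv_rhs => rw [hV]
  simp only [map_sum, map_add, map_smul, smul_eq_mul]
  simp only [pairing, Matrix.trace, Matrix.diag, Matrix.mul_apply, Complex.im_sum]
  rw [Finset.sum_comm]
  refine Finset.sum_congr rfl fun l _ => Finset.sum_congr rfl fun k _ => ?_
  simp [grad]
  ring

/-- The Gelfand–Dikij (quadratic) bracket on `𝔤`:
`{φ, ψ}(B) = ½⟨R(XB), YB⟩ - ½⟨R(BX), BY⟩` with `X = ∇φ(B)`, `Y = ∇ψ(B)`. -/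
def gdBracket {n : ℕ} (φ ψ : Mat n → ℝ) (B : Mat n) : ℝ :=
  (1 / 2) * pairing (rMap (grad φ B * B)) (grad ψ B * B)
    - (1 / 2) * pairing (rMap (B * grad φ B)) (B * grad ψ B)

/-- `Φ` is a smooth extension, near `C`, of the restriction of `φ` to the CMV matrices. -/
def IsExtension {n : ℕ} (C : Mat n) (φ Φ : Mat n → ℝ) : Prop :=
  ContDiffAt ℝ ∞ Φ C ∧ Φ =ᶠ[𝓝[cmvSet n] C] φ

/-- The bracket at `C` of `φ` and `ψ`, regarded as functions on the manifold of CMV matrices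
(only their values on CMV matrices near `C` matter), exists and equals `v`: smooth extensions to
a neighbourhood of `C` in `𝔤` exist, and all of them have Gelfand–Dikij bracket `v` at `C`. -/
def HasBracketAt {n : ℕ} (φ ψ : Mat n → ℝ) (v : ℝ) (C : Mat n) : Prop :=
  (∃ Φ, IsExtension C φ Φ) ∧ (∃ Ψ, IsExtension C ψ Ψ) ∧
    ∀ Φ Ψ, IsExtension C φ Φ → IsExtension C ψ Ψ → gdBracket Φ Ψ C = v

/-- `γ` is an integral curve, defined for all times, of the Hamiltonian vector field of `φ`:
`d/dt ψ(γ(t)) = {φ, ψ}(γ(t))` for every smooth function `ψ` on `𝔤`. -/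
def IsHamiltonianCurve {n : ℕ} (φ : Mat n → ℝ) (γ : ℝ → Mat n) : Prop :=
  ∀ ψ : Mat n → ℝ, ContDiff ℝ ∞ ψ →
    ∀ t : ℝ, HasDerivAt (fun s => ψ (γ s)) (gdBracket φ ψ (γ t)) t

/-- The Hamiltonian `φ(B) = Im tr f(B)`. -/
def hamiltonian {n : ℕ} (f : ℂ[X]) (B : Mat n) : ℝ := (Matrix.trace (aeval B f)).im

/-- `F(z) = 2 Re (z f'(z))`. -/
def bigF (f : ℂ[X]) (z : ℂ) : ℝ := 2 * (z * f.derivative.eval z).re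

/-! ### Spectral data -/

/-- The point `e^{iθ}` of the unit circle. -/
def pt (θ : ℝ) : ℂ := Complex.exp (θ * Complex.I)

/-- The mass at `z` of the spectral measure of `B` and `e₁`: `‖P e₁‖² = ⟨e₁, P e₁⟩`, with `P` the
orthogonal projection onto the eigenspace of `B` at `z`. -/
def mass {n : ℕ} [NeZero n] (B : Mat n) (z : ℂ) : ℝ :=
  ‖(Module.End.eigenspace (Matrix.toEuclideanLin B) z).starProjection
    (EuclideanSpace.single (0 : Fin n) (1 : ℂ))‖ ^ 2

/-- `e^{iϑ₁}, …, e^{iϑₙ}` is an enumeration, without repetition, of the eigenvalues of `B`. -/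
def IsSpectrum {n : ℕ} (B : Mat n) (ϑ : Fin n → ℝ) : Prop :=
  (Function.Injective fun j => pt (ϑ j)) ∧
    ∀ j, Module.End.HasEigenvalue (Matrix.toEuclideanLin B) (pt (ϑ j))

/-- `θ = (θ₁, …, θₙ)` is a continuous choice of the eigenvalue angles of the CMV matrices
near `C`. -/
def IsLabelling {n : ℕ} (C : Mat n) (θ : Mat n → Fin n → ℝ) : Prop :=
  (∀ᶠ B in 𝓝[cmvSet n] C, IsSpectrum B (θ B)) ∧ ContinuousWithinAt θ (cmvSet n) C

/-- The last of the indices. -/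
def lastIdx (n : ℕ) [NeZero n] : Fin n := ⟨n - 1, Nat.sub_lt (NeZero.pos n) Nat.one_pos⟩

end

end CMV

/-
Since `R` is skew, the Hamiltonian vector field of `φ` at `B` is `piA (B X) B - B piA (X B)` with
`X = ∇φ`, hence tangent to the unitary group; rewritten with `piL` in place of `piA` it acts by
triangular matrices with real diagonal, which preserve the staircase zero pattern of a CMV matrix
and the positivity of its corner entries. CMV matrices are exactly the unitary matrices of this
shape, so they are Poisson, and the value of a bracket does not depend on the extensions.

For `φ = Im tr f` the field is the Lax field `[piA (B f'(B)), B]`: the spectrum is constant along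
the flow, and the masses satisfy a logistic equation, which integrates explicitly. To first order,
every function of the angles is `Im tr f` for a polynomial `f`: choosing `f` with
`z_k f'(z_k) = δ_{kl}` at the eigenvalues reduces the brackets with `θ_l` to those with `Im tr f`.
-/

namespace CMV

noncomputable section

open scoped ComplexOrder Matrix

variable {n : ℕ}

section ODE

variable {E : Type*} [NormedAddCommGroup E] [NormedSpace ℝ E]

open scoped Manifold in
theorem exists_isIntegralCurve_of_hasCompactSupport [CompleteSpace E] {v : E → E}
    (hv : ContDiff ℝ 1 v) (hsupp : HasCompactSupport v) (x : E) :
    ∃ γ : ℝ → E, γ 0 = x ∧ IsIntegralCurve γ fun _ => v := by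
  obtain ⟨K, hK⟩ := hv.lipschitzWith_of_hasCompactSupport hsupp one_ne_zero
  obtain ⟨M, hM⟩ := hsupp.exists_bound_of_continuous hv.continuous
  obtain ⟨γ, hγ₀, hγ⟩ := (exists_isMIntegralCurve_iff_exists_isMIntegralCurveOn_Ioo (I := 𝓘(ℝ, E))
    (contMDiff_vectorSpace_iff_contDiff.2 hv) x).2 fun a => by
      have h₀ : (0 : ℝ) ∈ Set.Icc (-|a|) |a| := by simp
      have hPL : IsPicardLindelof (fun _ => v) ⟨0, h₀⟩ x (M.toNNReal * |a|.toNNReal) 0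
          M.toNNReal K :=
        { lipschitzOnWith := fun _ _ => hK.lipschitzOnWith
          continuousOn := fun _ _ => continuousOn_const
          norm_le := fun _ _ y _ => (hM y).trans (Real.le_coe_toNNReal M)
          mul_max_le := by simp }
      obtain ⟨γ, hγ₀, hγ⟩ := hPL.exists_eq_forall_mem_Icc_hasDerivWithinAt₀
      have hsub : Set.Ioo (-a) a ⊆ Set.Icc (-|a|) |a| := fun t ht => by
        rw [Set.mem_Icc, ← abs_le]
        exact (abs_lt.2 ht).le.trans (le_abs_self a)
      exact ⟨γ, hγ₀, fun t ht => ((hγ t (hsub ht)).mono hsub).hasFDerivWithinAt.hasMFDerivWithinAt⟩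
  exact ⟨γ, hγ₀, fun t => (hasDerivAt_iff_hasFDerivAt (𝕜 := ℝ) (F := E)).2
    (hasMFDerivAt_iff_hasFDerivAt.1 (hγ t))⟩

variable [FiniteDimensional ℝ E] {A : ℝ → E →ₗ[ℝ] E} {w : ℝ → E}

theorem eq_zero_of_isIntegralCurve_linear (hA : ∀ x, Continuous fun t => A t x)
    (hw : IsIntegralCurve w fun t => A t) (h₀ : w 0 = 0) (t : ℝ) : w t = 0 := by
  have hAc : Continuous fun s => LinearMap.toContinuousLinearMap (A s) := continuous_clm_apply.2 hA
  obtain ⟨M, hM⟩ := (isCompact_Icc (a := -(|t| + 1)) (b := |t| + 1)).exists_bound_of_continuousOn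
    hAc.continuousOn
  have hLip : ∀ s ∈ Set.Ioo (-(|t| + 1)) (|t| + 1), LipschitzOnWith M.toNNReal (A s) Set.univ :=
    fun s hs => ((LinearMap.toContinuousLinearMap (A s)).lipschitz.weaken <|
      NNReal.coe_le_coe.1 <| (hM s (Set.Ioo_subset_Icc_self hs)).trans
        (Real.le_coe_toNNReal M)).lipschitzOnWith
  refine ODE_solution_unique_of_mem_Ioo (t₀ := 0) (g := fun _ => 0) hLip ?_
    (fun s _ => ⟨hw s, trivial⟩) (fun s _ => ⟨?_, trivial⟩) h₀ ?_
  · exact ⟨by linarith [abs_nonneg t], by positivity⟩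
  · simpa using hasDerivAt_const s (0 : E)
  · exact abs_lt.1 (lt_add_one |t|)

theorem mem_of_isIntegralCurve_linear (hA : ∀ x, Continuous fun t => A t x)
    (hw : IsIntegralCurve w fun t => A t) {S : Submodule ℝ E} (hS : ∀ t, S ≤ S.comap (A t))
    (h₀ : w 0 ∈ S) (t : ℝ) : w t ∈ S := by
  have : IsClosed (S : Set E) := S.closed_of_finiteDimensional
  let π : E →L[ℝ] E ⧸ S := LinearMap.toContinuousLinearMap S.mkQ
  have hπ := eq_zero_of_isIntegralCurve_linear (A := fun t => S.mapQ S (A t) (hS t))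
    (w := fun t => π (w t)) ?_ (fun s => π.hasFDerivAt.comp_hasDerivAt s (hw s))
    ((Submodule.Quotient.mk_eq_zero S).2 h₀) t
  · exact (Submodule.Quotient.mk_eq_zero S).1 hπ
  · intro x
    obtain ⟨x, rfl⟩ := S.mkQ_surjective x
    exact π.continuous.comp (hA x)

end ODE

theorem eq_exp_integral_smul {E : Type*} [NormedAddCommGroup E] [NormedSpace ℝ E] {c : ℝ → ℝ}
    {w : ℝ → E} (hc : Continuous c) (hw : IsIntegralCurve w fun t x => c t • x) (t : ℝ) :
    w t = Real.exp (∫ s in (0 : ℝ)..t, c s) • w 0 := by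
  have hderiv : ∀ t, HasDerivAt (fun t => Real.exp (-∫ s in (0 : ℝ)..t, c s) • w t) 0 t := by
    intro t
    refine ((hc.integral_hasStrictDerivAt 0 t).hasDerivAt.fun_neg.exp.smul (hw t)).congr_deriv ?_
    rw [smul_smul, ← add_smul]
    ring_nf
    exact zero_smul ℝ _
  have hconst := is_const_of_deriv_eq_zero (fun t => (hderiv t).differentiableAt)
    (fun t => (hderiv t).deriv) t 0
  simp only [intervalIntegral.integral_same, neg_zero, Real.exp_zero, one_smul] at hconst
  rw [← hconst, smul_smul, ← Real.exp_add, add_neg_cancel, Real.exp_zero, one_smul]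

section MatrixCalculus

variable {ι κ o R E : Type*} [NormedRing R] [NormedAlgebra ℝ R]
  [NormedAddCommGroup E] [NormedSpace ℝ E]

theorem hasDerivAt_matrix [Finite ι] [Finite κ] {γ : ℝ → Matrix ι κ R} {D : Matrix ι κ R} {t : ℝ} :
    HasDerivAt γ D t ↔ ∀ i j, HasDerivAt (fun s => γ s i j) (D i j) t := by
  have := Fintype.ofFinite ι
  have := Fintype.ofFinite κ
  exact hasDerivAt_pi.trans (forall_congr' fun _ => hasDerivAt_pi)

theorem hasDerivAt_matrix_mul [Finite ι] [Fintype κ] [Finite o] {γ : ℝ → Matrix ι κ R}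
    {δ : ℝ → Matrix κ o R} {D : Matrix ι κ R} {D' : Matrix κ o R} {t : ℝ} (hγ : HasDerivAt γ D t)
    (hδ : HasDerivAt δ D' t) : HasDerivAt (fun s => γ s * δ s) (D * δ t + γ t * D') t := by
  rw [hasDerivAt_matrix] at *
  intro i j
  simp only [Matrix.mul_apply, Matrix.add_apply, ← Finset.sum_add_distrib]
  exact HasDerivAt.fun_sum fun k _ => (hγ i k).mul (hδ k j)

theorem hasDerivAt_conjTranspose [Finite ι] [Finite κ] [StarRing R] [StarModule ℝ R]
    [ContinuousStar R] {γ : ℝ → Matrix ι κ R} {D : Matrix ι κ R} {t : ℝ} (hγ : HasDerivAt γ D t) :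
    HasDerivAt (fun s => (γ s)ᴴ) Dᴴ t := by
  rw [hasDerivAt_matrix] at *
  exact fun i j => (hγ j i).star

variable [Fintype ι] [Fintype κ] [Fintype o] {k : WithTop ℕ∞} {x : E}

theorem contDiffAt_matrix {f : E → Matrix ι κ R} :
    ContDiffAt ℝ k f x ↔ ∀ i j, ContDiffAt ℝ k (fun e => f e i j) x :=
  contDiffAt_pi.trans (forall_congr' fun _ => contDiffAt_pi)

theorem contDiffAt_matrix_mul {f : E → Matrix ι κ R} {g : E → Matrix κ o R}
    (hf : ContDiffAt ℝ k f x) (hg : ContDiffAt ℝ k g x) :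
    ContDiffAt ℝ k (fun e => f e * g e) x := by
  rw [contDiffAt_matrix] at *
  intro i j
  simp only [Matrix.mul_apply]
  exact ContDiffAt.sum fun l _ => (hf i l).mul (hg l j)

theorem contDiff_matrix_mul {f : E → Matrix ι κ R} {g : E → Matrix κ o R} (hf : ContDiff ℝ k f)
    (hg : ContDiff ℝ k g) : ContDiff ℝ k fun e => f e * g e :=
  contDiff_iff_contDiffAt.2 fun _ => contDiffAt_matrix_mul hf.contDiffAt hg.contDiffAt

theorem contDiffAt_det {S : Type*} [NormedCommRing S] [NormedAlgebra ℝ S] [DecidableEq ι]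
    {f : E → Matrix ι ι S} (hf : ContDiffAt ℝ k f x) : ContDiffAt ℝ k (fun e => (f e).det) x := by
  simp only [Matrix.det_apply']
  exact ContDiffAt.sum fun σ _ => contDiffAt_const.mul
    (contDiffAt_prod fun i _ => contDiffAt_matrix.1 hf _ _)

end MatrixCalculus

theorem contDiff_aeval {k : WithTop ℕ∞} (p : ℂ[X]) :
    ContDiff ℝ k fun B : Mat n => aeval B p := by
  induction p using Polynomial.induction_on with
  | C a => simpa using contDiff_const
  | add p q hp hq => simpa using hp.add hq
  | monomial m a h =>
    simp only [pow_succ, ← mul_assoc, map_mul, aeval_X] at h ⊢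
    exact contDiff_matrix_mul h contDiff_id

/-- The projection `piA` as a real linear map, whence its smoothness. -/
def piALin (n : ℕ) : Mat n →ₗ[ℝ] Mat n where
  toFun := piA
  map_add' X Y := by
    ext i j
    simp only [piA, Matrix.of_apply, Matrix.add_apply]
    split_ifs <;> simp [mul_add, add_comm]
  map_smul' c X := by
    ext i j
    simp only [piA, Matrix.of_apply, Matrix.smul_apply]
    split_ifs <;> simp [mul_left_comm]

theorem contDiff_piA {k : WithTop ℕ∞} : ContDiff ℝ k (piA : Mat n → Mat n) :=
  (piALin n).toContinuousLinearMap.contDiff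

theorem continuous_piA : Continuous (piA : Mat n → Mat n) :=
  contDiff_piA (k := 0) |>.continuous

theorem continuous_piL : Continuous (piL : Mat n → Mat n) :=
  continuous_id.sub continuous_piA

theorem piL_add_piA (X : Mat n) : piL X + piA X = X :=
  sub_add_cancel _ _

theorem pairing_comm (X Y : Mat n) : pairing X Y = pairing Y X := by
  rw [pairing, pairing, Matrix.trace_mul_comm]

theorem pairing_mul_right (X Y B : Mat n) : pairing X (Y * B) = pairing (B * X) Y := by
  rw [pairing, pairing, ← Matrix.trace_mul_cycle, Matrix.mul_assoc]

theorem pairing_mul_left (X Y B : Mat n) : pairing X (B * Y) = pairing (X * B) Y := by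
  rw [pairing, pairing, Matrix.mul_assoc]

theorem pairing_piA_piA (X Y : Mat n) : pairing (piA X) (piA Y) = 0 := by
  have h : star (piA X * piA Y).trace = (piA X * piA Y).trace := by
    rw [← Matrix.trace_conjTranspose, Matrix.conjTranspose_mul, piA_conjTranspose,
      piA_conjTranspose, neg_mul_neg, Matrix.trace_mul_comm]
  exact Complex.conj_eq_iff_im.1 h

theorem pairing_piL_piL (X Y : Mat n) : pairing (piL X) (piL Y) = 0 := by
  simp only [pairing, Matrix.trace, Matrix.diag, Matrix.mul_apply, Complex.im_sum]
  refine Finset.sum_eq_zero fun i _ => Finset.sum_eq_zero fun k _ => ?_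
  rcases lt_trichotomy i k with h | rfl | h
  · simp [piL_apply_of_lt X h]
  · simp [piL_diag_im]
  · simp [piL_apply_of_lt Y h]

theorem pairing_rMap (X Y : Mat n) : pairing (rMap X) Y = -pairing X (rMap Y) := by
  have hA := pairing_piA_piA X Y
  have hL := pairing_piL_piL X Y
  conv_lhs => rw [← piL_add_piA Y]
  conv_rhs => rw [← piL_add_piA X]
  simp only [rMap, pairing, add_mul, mul_add, sub_mul, mul_sub, Matrix.trace_add, Matrix.trace_sub,
    Complex.add_im, Complex.sub_im] at hA hL ⊢
  linarith

theorem gdBracket_antisymm (φ ψ : Mat n → ℝ) (B : Mat n) :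
    gdBracket φ ψ B = -gdBracket ψ φ B := by
  rw [gdBracket, gdBracket, pairing_rMap, pairing_rMap, pairing_comm _ (rMap _),
    pairing_comm _ (rMap _)]
  ring

/-- The value at `B` of the Hamiltonian vector field, with respect to the Gelfand–Dikij bracket, of
a function with gradient `X` at `B`. -/
def hamVec (X B : Mat n) : Mat n := piA (B * X) * B - B * piA (X * B)

theorem hamVec_eq_piL (X B : Mat n) : hamVec X B = B * piL (X * B) - piL (B * X) * B := by
  simp only [hamVec, piL, mul_sub, sub_mul, Matrix.mul_assoc]
  abel

theorem hamVec_of_commute {X B : Mat n} (h : Commute X B) :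
    hamVec X B = piA (B * X) * B - B * piA (B * X) := by
  rw [hamVec, h.eq]

theorem two_smul_hamVec (X B : Mat n) :
    (2 : ℝ) • hamVec X B = B * rMap (X * B) - rMap (B * X) * B := by
  rw [two_smul]
  nth_rw 1 [hamVec]
  rw [hamVec_eq_piL, rMap, rMap, mul_sub, sub_mul]
  abel

theorem gdBracket_eq_fderiv (φ ψ : Mat n → ℝ) (B : Mat n) :
    gdBracket φ ψ B = fderiv ℝ ψ B (hamVec (grad φ B) B) := by
  have h : 2 * gdBracket φ ψ B = fderiv ℝ ψ B ((2 : ℝ) • hamVec (grad φ B) B) := by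
    rw [← pairing_grad, two_smul_hamVec, gdBracket, pairing_mul_right, pairing_mul_left]
    simp only [pairing, mul_sub, Matrix.trace_sub, Complex.sub_im, ← Matrix.mul_assoc]
    rw [Matrix.trace_mul_cycle B, Matrix.trace_mul_cycle (rMap _) B]
    ring
  rw [map_smul, smul_eq_mul] at h
  linarith

section TriangularFlow

variable {ι : Type*} [Fintype ι] [LinearOrder ι] {γ l₁ l₂ : ℝ → Matrix ι ι ℂ}

theorem apply_eq_zero_of_triangular_ode {Ω : ι → ι → Prop}
    (hΩ : ∀ ⦃i j i' j'⦄, Ω i j → i' ≤ i → j ≤ j' → Ω i' j') (hl₁ : Continuous l₁)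
    (hl₂ : Continuous l₂) (ht₁ : ∀ t i j, i < j → l₁ t i j = 0)
    (ht₂ : ∀ t i j, i < j → l₂ t i j = 0)
    (hγ : IsIntegralCurve γ fun t B => B * l₂ t - l₁ t * B) (h₀ : ∀ i j, Ω i j → γ 0 i j = 0)
    (t : ℝ) (i j : ι) (hij : Ω i j) : γ t i j = 0 := by
  let S : Submodule ℝ (Matrix ι ι ℂ) :=
    { carrier := {B | ∀ i j, Ω i j → B i j = 0}
      add_mem' := fun hX hY i j h => by simp [hX i j h, hY i j h]
      zero_mem' := fun _ _ _ => rfl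
      smul_mem' := fun c X hX i j h => by simp [hX i j h] }
  refine mem_of_isIntegralCurve_linear (S := S)
    (A := fun t => LinearMap.mulRight ℝ (l₂ t) - LinearMap.mulLeft ℝ (l₁ t))
    (fun B => (continuous_const.mul hl₂).sub (hl₁.mul continuous_const)) hγ ?_ h₀ t i j hij
  intro t B hB i j h
  have hr : (B * l₂ t) i j = 0 := Finset.sum_eq_zero fun k _ => by
    rcases lt_or_ge k j with hk | hk
    · simp [ht₂ t k j hk]
    · simp [hB i k (hΩ h le_rfl hk)]
  have hl : (l₁ t * B) i j = 0 := Finset.sum_eq_zero fun k _ => by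
    rcases lt_or_ge i k with hk | hk
    · simp [ht₁ t i k hk]
    · simp [hB k j (hΩ h hk le_rfl)]
  simp [hr, hl]

theorem corner_pos_of_triangular_ode (hl₁ : Continuous l₁) (hl₂ : Continuous l₂)
    (ht₁ : ∀ t i j, i < j → l₁ t i j = 0) (ht₂ : ∀ t i j, i < j → l₂ t i j = 0)
    (hd₁ : ∀ t i, (l₁ t i i).im = 0) (hd₂ : ∀ t i, (l₂ t i i).im = 0)
    (hγ : IsIntegralCurve γ fun t B => B * l₂ t - l₁ t * B) {i j : ι}
    (hrow : ∀ t k, j < k → γ t i k = 0) (hcol : ∀ t k, k < i → γ t k j = 0)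
    (h₀ : 0 < γ 0 i j) (t : ℝ) : 0 < γ t i j := by
  have hode : IsIntegralCurve (fun t => γ t i j) fun t z =>
      ((l₂ t j j).re - (l₁ t i i).re) • z := by
    intro t
    refine (hasDerivAt_matrix.1 (hγ t) i j).congr_deriv ?_
    have hr : (γ t * l₂ t) i j = γ t i j * l₂ t j j :=
      Finset.sum_eq_single j (fun k _ hk => by
        rcases lt_or_gt_of_ne hk with h | h
        · simp [ht₂ t k j h]
        · simp [hrow t k h]) (by simp)
    have hl : (l₁ t * γ t) i j = l₁ t i i * γ t i j :=
      Finset.sum_eq_single i (fun k _ hk => by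
        rcases lt_or_gt_of_ne hk with h | h
        · simp [hcol t k h]
        · simp [ht₁ t i k h]) (by simp)
    change (γ t * l₂ t) i j - (l₁ t * γ t) i j = _
    rw [hr, hl, ← Complex.re_add_im (l₂ t j j), ← Complex.re_add_im (l₁ t i i),
      hd₁, hd₂]
    simp only [Complex.ofReal_zero, zero_mul, add_zero, Complex.real_smul, Complex.ofReal_sub]
    ring
  rw [eq_exp_integral_smul (by fun_prop) hode t]
  exact smul_pos (Real.exp_pos _) h₀

end TriangularFlow

/-- The zero pattern of CMV matrices, with positive entries at its corners: among the unitary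
matrices it characterizes `cmvSet`, and it is visibly preserved by triangular flows. -/
structure IsCMVShape (B : Mat n) : Prop where
  upper : ∀ i j : Fin n, 2 * ((i : ℕ) / 2) + 2 < j → B i j = 0
  lower : ∀ i j : Fin n, 2 * (((j : ℕ) + 1) / 2) + 1 < i → B i j = 0
  upper_corner : ∀ i j : Fin n, (i : ℕ) % 2 = 0 → (j : ℕ) = i + 2 → 0 < B i j
  lower_corner : ∀ i j : Fin n, (i : ℕ) = 1 ∧ (j : ℕ) = 0 ∨ (j : ℕ) % 2 = 1 ∧ (i : ℕ) = j + 2 →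
    0 < B i j

section HamiltonianFlow

variable {X γ : ℝ → Mat n}

theorem mem_unitaryGroup_of_hamVec (hX : Continuous X)
    (hγ : IsIntegralCurve γ fun t B => hamVec (X t) B)
    (h₀ : γ 0 ∈ Matrix.unitaryGroup (Fin n) ℂ) (t : ℝ) :
    γ t ∈ Matrix.unitaryGroup (Fin n) ℂ := by
  let A : ℝ → Mat n := fun t => piA (X t * γ t)
  have hA : Continuous A := continuous_piA.comp (hX.matrix_mul hγ.continuous)
  refine Matrix.mem_unitaryGroup_iff'.2 <| sub_eq_zero.1 <|
    eq_zero_of_isIntegralCurve_linear (w := fun t => star (γ t) * γ t - 1)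
      (A := fun t => LinearMap.mulLeft ℝ (A t) - LinearMap.mulRight ℝ (A t))
      (fun B => (hA.mul continuous_const).sub (continuous_const.mul hA)) (fun t => ?_)
      (sub_eq_zero.2 <| Matrix.mem_unitaryGroup_iff'.1 h₀) t
  refine ((hasDerivAt_matrix_mul (hasDerivAt_conjTranspose (hγ t)) (hγ t)).sub_const
    1).congr_deriv ?_
  simp only [hamVec, Matrix.conjTranspose_sub, Matrix.conjTranspose_mul, piA_conjTranspose,
    LinearMap.sub_apply, LinearMap.mulLeft_apply, LinearMap.mulRight_apply,
    Matrix.star_eq_conjTranspose, A]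
  noncomm_ring

theorem hamVec_conjTranspose {B : Mat n} (hB : B ∈ Matrix.unitaryGroup (Fin n) ℂ) (X : Mat n) :
    (hamVec X B)ᴴ = Bᴴ * piL (B * X) - piL (X * B) * Bᴴ := by
  have h₁ : Bᴴ * B = 1 := Matrix.mem_unitaryGroup_iff'.1 hB
  have h₂ : B * Bᴴ = 1 := Matrix.mem_unitaryGroup_iff.1 hB
  have hX : Bᴴ * (B * X) = X * B * Bᴴ := by
    rw [← Matrix.mul_assoc, h₁, Matrix.mul_assoc, h₂, Matrix.one_mul, Matrix.mul_one]
  simp only [hamVec, piL, Matrix.conjTranspose_sub, Matrix.conjTranspose_mul, piA_conjTranspose,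
    mul_sub, sub_mul, hX]
  noncomm_ring

theorem isCMVShape_of_hamVec (hX : Continuous X)
    (hγ : IsIntegralCurve γ fun t B => hamVec (X t) B)
    (h₀ : γ 0 ∈ Matrix.unitaryGroup (Fin n) ℂ) (hs : IsCMVShape (γ 0)) (t : ℝ) :
    IsCMVShape (γ t) := by
  have hl₁ : Continuous fun t => piL (γ t * X t) :=
    continuous_piL.comp (hγ.continuous.matrix_mul hX)
  have hl₂ : Continuous fun t => piL (X t * γ t) :=
    continuous_piL.comp (hX.matrix_mul hγ.continuous)
  have ht₁ : ∀ t i j, i < j → piL (γ t * X t) i j = 0 := fun t _ _ => piL_apply_of_lt _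
  have ht₂ : ∀ t i j, i < j → piL (X t * γ t) i j = 0 := fun t _ _ => piL_apply_of_lt _
  have hγ₁ : IsIntegralCurve γ fun t B => B * piL (X t * γ t) - piL (γ t * X t) * B := fun t => by
    simpa only [hamVec_eq_piL] using hγ t
  have hγ₂ : IsIntegralCurve (fun t => (γ t)ᴴ) fun t B =>
      B * piL (γ t * X t) - piL (X t * γ t) * B := fun t =>
    (hasDerivAt_conjTranspose (hγ t)).congr_deriv
      (hamVec_conjTranspose (mem_unitaryGroup_of_hamVec hX hγ h₀ t) _)
  have hu := apply_eq_zero_of_triangular_ode (Ω := fun i j : Fin n => 2 * ((i : ℕ) / 2) + 2 < j)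
    (fun i j i' j' h hi hj => by rw [Fin.le_def] at hi hj; omega) hl₁ hl₂ ht₁ ht₂ hγ₁ hs.upper
  have hl := apply_eq_zero_of_triangular_ode
    (Ω := fun i j : Fin n => 2 * (((i : ℕ) + 1) / 2) + 1 < j)
    (fun i j i' j' h hi hj => by rw [Fin.le_def] at hi hj; omega) hl₂ hl₁ ht₂ ht₁ hγ₂
    (fun i j h => by simp [hs.lower j i h])
  refine ⟨hu t, fun i j h => by simpa using hl t j i h, fun i j hi hj => ?_, fun i j h => ?_⟩
  · exact corner_pos_of_triangular_ode hl₁ hl₂ ht₁ ht₂ (fun t => piL_diag_im _)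
      (fun t => piL_diag_im _) hγ₁ (fun t k hk => hu t i k (by rw [Fin.lt_def] at hk; omega))
      (fun t k hk => hu t k j (by rw [Fin.lt_def] at hk; omega)) (hs.upper_corner i j hi hj) t
  · have hpos := corner_pos_of_triangular_ode hl₂ hl₁ ht₂ ht₁ (fun t => piL_diag_im _)
      (fun t => piL_diag_im _) hγ₂ (i := j) (j := i)
      (fun t k hk => hl t j k (by rw [Fin.lt_def] at hk; omega))
      (fun t k hk => hl t k i (by rw [Fin.lt_def] at hk; omega))
      (star_pos_iff.2 (hs.lower_corner i j h)) t
    exact star_pos_iff.1 hpos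

end HamiltonianFlow

/-- The block matrix `diag(1, A)`. It turns an `n × n` CMV matrix into the right factor of an
`(n + 1) × (n + 1)` one, in the induction on the size. -/
def bord (A : Mat n) : Mat (n + 1) :=
  Matrix.of (Fin.cons (Fin.cons 1 0) fun i => Fin.cons 0 (A i))

@[simp] theorem bord_zero_zero (A : Mat n) : bord A 0 0 = 1 := rfl

@[simp] theorem bord_zero_succ (A : Mat n) (j : Fin n) : bord A 0 j.succ = 0 := rfl

@[simp] theorem bord_succ_zero (A : Mat n) (i : Fin n) : bord A i.succ 0 = 0 := rfl

@[simp] theorem bord_succ_succ (A : Mat n) (i j : Fin n) : bord A i.succ j.succ = A i j := rfl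

@[simp] theorem bord_zero_one (A : Mat (n + 1)) : bord A 0 1 = 0 := rfl

@[simp] theorem bord_one_one (A : Mat (n + 1)) : bord A 1 1 = A 0 0 := rfl

@[simp] theorem bord_succ_one (A : Mat (n + 1)) (i : Fin (n + 1)) : bord A i.succ 1 = A i 0 := rfl

@[simp] theorem bord_one_zero (A : Mat (n + 1)) : bord A 1 0 = 0 := rfl

@[simp] theorem bord_one_succ (A : Mat (n + 1)) (j : Fin (n + 1)) : bord A 1 j.succ = A 0 j := rfl

theorem eq_bord_iff {A : Mat n} {B : Mat (n + 1)} : B = bord A ↔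
    B 0 0 = 1 ∧ (∀ j : Fin n, B 0 j.succ = 0) ∧ (∀ i : Fin n, B i.succ 0 = 0) ∧
      ∀ i j : Fin n, B i.succ j.succ = A i j := by
  simp only [← Matrix.ext_iff, Fin.forall_fin_succ, bord_zero_zero, bord_zero_succ, bord_succ_zero,
    bord_succ_succ]
  exact ⟨fun ⟨⟨h₁, h₂⟩, h₃⟩ => ⟨h₁, h₂, fun i => (h₃ i).1, fun i => (h₃ i).2⟩,
    fun ⟨h₁, h₂, h₃, h₄⟩ => ⟨⟨h₁, h₂⟩, fun i => ⟨h₃ i, h₄ i⟩⟩⟩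

theorem bord_injective : Function.Injective (bord : Mat n → Mat (n + 1)) := fun _ _ h =>
  Matrix.ext fun i j => congrFun (congrFun h i.succ) j.succ

theorem bord_mul (A B : Mat n) : bord A * bord B = bord (A * B) := by
  simp [eq_bord_iff, Matrix.mul_apply, Fin.sum_univ_succ]

theorem bord_one : bord (1 : Mat n) = 1 := by
  refine (eq_bord_iff.2 ?_).symm
  simp [Matrix.one_apply, Fin.succ_ne_zero, (Fin.succ_ne_zero _).symm]

theorem bord_transpose (A : Mat n) : (bord A)ᵀ = bord Aᵀ := by
  simp [eq_bord_iff]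

theorem bord_conjTranspose (A : Mat n) : (bord A)ᴴ = bord Aᴴ := by
  simp [eq_bord_iff]

theorem bord_mem_unitaryGroup_iff {A : Mat n} :
    bord A ∈ Matrix.unitaryGroup (Fin (n + 1)) ℂ ↔ A ∈ Matrix.unitaryGroup (Fin n) ℂ := by
  rw [Matrix.mem_unitaryGroup_iff, Matrix.mem_unitaryGroup_iff, Matrix.star_eq_conjTranspose,
    Matrix.star_eq_conjTranspose, bord_conjTranspose, bord_mul, ← bord_one, bord_injective.eq_iff]

/-- The block matrix `diag(Ξ, 1, …, 1)` with `Ξ = xi a`, the left factor of a CMV matrix that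
carries its first coefficient. -/
def rot (n : ℕ) (a : ℂ) : Mat (n + 2) :=
  Matrix.of fun i j =>
    if (i : ℕ) / 2 = 0 ∧ (j : ℕ) / 2 = 0 then xi a (Fin.ofNat 2 (i : ℕ)) (Fin.ofNat 2 (j : ℕ))
    else if i = j then 1 else 0

section Rot

variable (a : ℂ) (A : Mat (n + 2)) (j : Fin (n + 2))

theorem rot_mul_zero : (rot n a * A) 0 j = star a * A 0 j + √(1 - ‖a‖ ^ 2) * A 1 j := by
  rw [Matrix.mul_apply, Fin.sum_univ_succ, Fin.sum_univ_succ, Finset.sum_eq_zero]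
  · simp [rot, xi]
  · intro k _
    simp [rot, (Fin.succ_ne_zero _).symm]

theorem rot_mul_one : (rot n a * A) 1 j = √(1 - ‖a‖ ^ 2) * A 0 j - a * A 1 j := by
  rw [Matrix.mul_apply, Fin.sum_univ_succ, Fin.sum_univ_succ, Finset.sum_eq_zero]
  · simp [rot, xi, sub_eq_add_neg]
  · intro k _
    have h : (1 : Fin (n + 2)) ≠ k.succ.succ := by simp [Fin.ext_iff]
    simp [rot, h]

theorem rot_mul_succ_succ (i : Fin n) : (rot n a * A) i.succ.succ j = A i.succ.succ j := by
  rw [Matrix.mul_apply, Finset.sum_eq_single i.succ.succ]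
  · simp [rot]
  · intro k _ hk
    simp [rot, hk.symm]
  · simp

end Rot

theorem xi_symm (a : ℂ) (p q : Fin 2) : xi a p q = xi a q p := by
  fin_cases p <;> fin_cases q <;> simp [xi]

theorem star_xi (a : ℂ) (p q : Fin 2) : star (xi a p q) = xi (star a) p q := by
  fin_cases p <;> fin_cases q <;> simp [xi]

theorem rot_conjTranspose (a : ℂ) : (rot n a)ᴴ = rot n (star a) := by
  ext i j
  simp only [rot, Matrix.conjTranspose_apply, Matrix.of_apply, and_comm (a := (j : ℕ) / 2 = 0),
    eq_comm (a := j)]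
  split_ifs
  · rw [star_xi, xi_symm]
  · simp
  · simp

theorem sq_sqrt_one_sub_norm_sq {a : ℂ} (ha : ‖a‖ ≤ 1) :
    (√(1 - ‖a‖ ^ 2) : ℂ) ^ 2 = 1 - star a * a := by
  rw [← Complex.ofReal_pow, Real.sq_sqrt (by nlinarith [norm_nonneg a])]
  simp [Complex.conj_mul']

theorem rot_star_mul_rot_mul {a : ℂ} (ha : ‖a‖ ≤ 1) (A : Mat (n + 2)) :
    rot n (star a) * (rot n a * A) = A := by
  have hs := sq_sqrt_one_sub_norm_sq ha
  ext i j
  revert i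
  simp only [Fin.forall_fin_succ, Fin.succ_zero_eq_one, rot_mul_zero, rot_mul_one,
    rot_mul_succ_succ, star_star, norm_star, implies_true, and_true]
  exact ⟨by linear_combination A 0 j * hs, by linear_combination A 1 j * hs⟩

theorem rot_mem_unitaryGroup {a : ℂ} (ha : ‖a‖ ≤ 1) :
    rot n a ∈ Matrix.unitaryGroup (Fin (n + 2)) ℂ := by
  rw [Matrix.mem_unitaryGroup_iff', Matrix.star_eq_conjTranspose, rot_conjTranspose]
  simpa using rot_star_mul_rot_mul ha 1

theorem ofNat_two_add_two (k : ℕ) : Fin.ofNat 2 (k + 2) = Fin.ofNat 2 k := by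
  simp [Fin.ext_iff]

theorem matL_transpose (α : ℕ → ℂ) : (matL n α)ᵀ = matL n α := by
  ext i j
  simp only [matL, Matrix.transpose_apply, Matrix.of_apply, eq_comm (a := (j : ℕ) / 2)]
  split_ifs with h
  · rw [xi_symm, h]
  · rfl

theorem matM_succ (α : ℕ → ℂ) : matM (n + 1) α = bord (matL n fun k => α (k + 1)) := by
  refine eq_bord_iff.2 ⟨by simp [matM], fun j => ?_, fun i => ?_, fun i j => ?_⟩
  · have : ¬ 0 = ((j : ℕ) + 1 + 1) / 2 := by omega
    simp [matM, this]
  · have : ¬ ((i : ℕ) + 1 + 1) / 2 = 0 := by omega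
    simp [matM, this]
  · have : 2 * ((i : ℕ) / 2 + 1) - 1 = 2 * ((i : ℕ) / 2) + 1 := by omega
    simp [-Fin.ofNat_eq_cast, matM, matL, add_assoc, ofNat_two_add_two, this]

theorem matM_transpose (α : ℕ → ℂ) : (matM (n + 1) α)ᵀ = matM (n + 1) α := by
  rw [matM_succ, bord_transpose, matL_transpose]

theorem matL_succ_succ (α : ℕ → ℂ) :
    matL (n + 2) α = rot n (α 0) * bord (matM (n + 1) fun k => α (k + 1)) := by
  ext i j
  revert i j
  simp only [Fin.forall_fin_succ, Fin.succ_zero_eq_one, rot_mul_zero, rot_mul_one,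
    rot_mul_succ_succ]
  have hcol (j : Fin n) : ¬ 0 = ((j : ℕ) + 1 + 1) / 2 := by omega
  have hrow (i : Fin n) : ¬ ((i : ℕ) + 1 + 1) / 2 = 0 := by omega
  refine ⟨⟨by simp [matL, xi], by simp [matL, xi, matM], fun j => by simp [matL, matM, hcol]⟩,
    ⟨by simp [matL, xi], by simp [matL, xi, matM], fun j => by simp [matL, matM, hcol]⟩,
    fun i => ⟨by simp [matL, hrow], by simp [matL, matM, hrow], fun j => ?_⟩⟩
  have h : 2 * ((i : ℕ) / 2 + 1) - 1 + 1 = 2 * ((i : ℕ) / 2 + 1) := by omega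
  simp [-Fin.ofNat_eq_cast, matL, matM, add_assoc, ofNat_two_add_two, h]

theorem cmvMatrix_succ_succ (α : ℕ → ℂ) : cmvMatrix (n + 2) α =
    rot n (α 0) * bord (cmvMatrix (n + 1) fun k => α (k + 1))ᵀ := by
  rw [cmvMatrix, cmvMatrix, Matrix.transpose_mul, matL_transpose, matM_transpose,
    ← bord_mul, ← Matrix.mul_assoc, ← matL_succ_succ, ← matM_succ]

theorem mem_cmvSet_one {C : Mat 1} : C ∈ cmvSet 1 ↔ C ∈ Matrix.unitaryGroup (Fin 1) ℂ := by
  have hC : C ∈ Matrix.unitaryGroup (Fin 1) ℂ ↔ ‖C 0 0‖ = 1 := by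
    rw [Matrix.mem_unitaryGroup_iff, ← Matrix.ext_iff]
    simp [Matrix.mul_apply, Complex.mul_conj', ← Complex.ofReal_pow, Complex.ofReal_eq_one,
      pow_eq_one_iff_of_nonneg]
  have hcmv (α : ℕ → ℂ) : cmvMatrix 1 α 0 0 = star (α 0) := by
    simp [cmvMatrix, matL, matM, xi, Matrix.mul_apply]
  rw [hC]
  refine ⟨?_, fun h => ⟨fun _ => star (C 0 0), by simp, by simpa using h, ?_⟩⟩
  · rintro ⟨α, -, hα, rfl⟩
    simpa [hcmv] using hα
  · ext i j
    rw [Subsingleton.elim i 0, Subsingleton.elim j 0, hcmv, star_star]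

theorem mem_cmvSet_succ_succ {C : Mat (n + 2)} : C ∈ cmvSet (n + 2) ↔
    ∃ a : ℂ, ‖a‖ < 1 ∧ ∃ B ∈ cmvSet (n + 1), C = rot n a * bord Bᵀ := by
  constructor
  · rintro ⟨α, hα, hα₁, rfl⟩
    exact ⟨α 0, hα 0 (by omega), _, ⟨fun k => α (k + 1), fun k hk => hα (k + 1) (by omega), hα₁,
      rfl⟩, cmvMatrix_succ_succ α⟩
  · rintro ⟨a, ha, _, ⟨α, hα, hα₁, rfl⟩, rfl⟩
    let α' : ℕ → ℂ := fun k => k.casesOn a α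
    refine ⟨α', ?_, hα₁, (cmvMatrix_succ_succ α').symm⟩
    rintro (_ | k) hk
    exacts [ha, hα k (by omega)]

theorem rot_mul_bord_mem_unitaryGroup_iff {a : ℂ} (ha : ‖a‖ ≤ 1) {B : Mat (n + 1)} :
    rot n a * bord Bᵀ ∈ Matrix.unitaryGroup (Fin (n + 2)) ℂ ↔
      B ∈ Matrix.unitaryGroup (Fin (n + 1)) ℂ := by
  rw [← Matrix.transpose_mem_unitaryGroup_iff (U := B), ← bord_mem_unitaryGroup_iff (A := Bᵀ)]
  refine ⟨fun h => ?_, mul_mem (rot_mem_unitaryGroup ha)⟩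
  rw [← rot_star_mul_rot_mul ha (bord Bᵀ)]
  exact mul_mem (rot_mem_unitaryGroup (by rwa [norm_star])) h

theorem sqrt_one_sub_norm_sq_pos {a : ℂ} (ha : ‖a‖ < 1) : (0 : ℂ) < √(1 - ‖a‖ ^ 2) := by
  have : 0 < 1 - ‖a‖ ^ 2 := by nlinarith [norm_nonneg a]
  exact_mod_cast Real.sqrt_pos.2 this

theorem IsCMVShape.rot_mul_bord {a : ℂ} (ha : ‖a‖ < 1) {B : Mat (n + 1)} (hs : IsCMVShape B) :
    IsCMVShape (rot n a * bord Bᵀ) := by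
  have hρ := sqrt_one_sub_norm_sq_pos ha
  have h₀ (j : Fin (n + 1)) : (rot n a * bord Bᵀ) 0 j.succ = √(1 - ‖a‖ ^ 2) * B j 0 := by
    simp [rot_mul_zero]
  have h₁ (j : Fin (n + 1)) : (rot n a * bord Bᵀ) 1 j.succ = -(a * B j 0) := by
    simp [rot_mul_one]
  have h₂ (i : Fin n) (j : Fin (n + 1)) :
      (rot n a * bord Bᵀ) i.succ.succ j.succ = B j i.succ := by
    simp [rot_mul_succ_succ]
  have hcases (i : Fin (n + 2)) : i = 0 ∨ i = 1 ∨ ∃ k : Fin n, i = k.succ.succ := by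
    obtain rfl | ⟨k, rfl⟩ := Fin.eq_zero_or_eq_succ i
    · exact Or.inl rfl
    · obtain rfl | ⟨k, rfl⟩ := Fin.eq_zero_or_eq_succ k
      exacts [Or.inr (Or.inl rfl), Or.inr (Or.inr ⟨k, rfl⟩)]
  refine ⟨fun i j hij => ?_, fun i j hij => ?_, fun i j hi hij => ?_, fun i j hij => ?_⟩ <;>
    obtain rfl | ⟨j, rfl⟩ := Fin.eq_zero_or_eq_succ j <;>
    obtain rfl | rfl | ⟨k, rfl⟩ := hcases i <;> try (exfalso; simp at *; done)
  · rw [h₀, hs.lower _ _ (by simp at *; omega), mul_zero]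
  · rw [h₁, hs.lower _ _ (by simp at *; omega), mul_zero, neg_zero]
  · rw [h₂, hs.lower _ _ (by simp at *; omega)]
  · rw [rot_mul_succ_succ, bord_succ_zero]
  · rw [h₂]
    exact hs.upper _ _ (by simp at *; omega)
  · rw [h₀]
    exact mul_pos hρ (hs.lower_corner _ _ (by simp at *; omega))
  · rw [h₂]
    exact hs.lower_corner _ _ (by simp at *; omega)
  · simpa [rot_mul_one] using hρ
  · rw [h₂]
    exact hs.upper_corner _ _ (by simp at *; omega) (by simp at *; omega)

theorem IsCMVShape.of_rot_mul_bord {a : ℂ} (ha : ‖a‖ < 1) {B : Mat (n + 1)}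
    (hs : IsCMVShape (rot n a * bord Bᵀ)) : IsCMVShape B := by
  have hρ := sqrt_one_sub_norm_sq_pos ha
  have h₀ (i : Fin (n + 1)) : (rot n a * bord Bᵀ) 0 i.succ = √(1 - ‖a‖ ^ 2) * B i 0 := by
    simp [rot_mul_zero]
  have h₂ (i : Fin n) (j : Fin (n + 1)) :
      (rot n a * bord Bᵀ) i.succ.succ j.succ = B j i.succ := by
    simp [rot_mul_succ_succ]
  refine ⟨fun i j hij => ?_, fun i j hij => ?_, fun i j hi hij => ?_, fun i j hij => ?_⟩ <;>
    obtain rfl | ⟨k, rfl⟩ := Fin.eq_zero_or_eq_succ j <;> try (exfalso; simp at *; done)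
  · rw [← h₂]
    exact hs.lower _ _ (by simp at *; omega)
  · have h := hs.upper 0 i.succ (by simp at *; omega)
    exact (mul_eq_zero.1 ((h₀ i).symm.trans h)).resolve_left hρ.ne'
  · rw [← h₂]
    exact hs.upper _ _ (by simp at *; omega)
  · rw [← h₂]
    exact hs.lower_corner _ _ (by simp at *; omega)
  · exact (mul_pos_iff_of_pos_left hρ).1 (h₀ i ▸ hs.upper_corner _ _ rfl (by simp at *; omega))
  · rw [← h₂]
    exact hs.upper_corner _ _ (by simp at *; omega) (by simp at *; omega)

theorem apply_succ_zero_eq_zero_of_mem_unitaryGroup {A : Mat (n + 1)}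
    (hA : A ∈ Matrix.unitaryGroup (Fin (n + 1)) ℂ) (h : A 0 0 = 1) (i : Fin n) :
    A i.succ 0 = 0 := by
  have hsum : ∑ i : Fin n, star (A i.succ 0) * A i.succ 0 = 0 := by
    simpa [Matrix.mul_apply, Fin.sum_univ_succ, h] using
      congrFun (congrFun (Matrix.mem_unitaryGroup_iff'.1 hA) 0) 0
  simpa using (Finset.sum_eq_zero_iff_of_nonneg fun i _ => star_mul_self_nonneg _).1 hsum i

theorem exists_eq_bord_of_mem_unitaryGroup {A : Mat (n + 1)}
    (hA : A ∈ Matrix.unitaryGroup (Fin (n + 1)) ℂ) (h : A 0 0 = 1) : ∃ B, A = bord B :=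
  ⟨Matrix.of fun i j => A i.succ j.succ, eq_bord_iff.2 ⟨h,
    apply_succ_zero_eq_zero_of_mem_unitaryGroup (Matrix.transpose_mem_unitaryGroup_iff.2 hA) h,
    apply_succ_zero_eq_zero_of_mem_unitaryGroup hA h, fun _ _ => rfl⟩⟩

/- The first column of `C` is supported on the first two entries, so a rotation moves it to the
first basis vector. -/
theorem exists_eq_rot_mul_bord {C : Mat (n + 2)} (hC : C ∈ Matrix.unitaryGroup (Fin (n + 2)) ℂ)
    (hs : IsCMVShape C) : ∃ a : ℂ, ‖a‖ < 1 ∧ ∃ B : Mat (n + 1), C = rot n a * bord Bᵀ := by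
  have hcol (i : Fin n) : C i.succ.succ 0 = 0 :=
    hs.lower _ _ (by simp)
  have hnorm : star (C 0 0) * C 0 0 + star (C 1 0) * C 1 0 = 1 := by
    simpa [Matrix.mul_apply, Fin.sum_univ_succ, hcol] using
      congrFun (congrFun (Matrix.mem_unitaryGroup_iff'.1 hC) 0) 0
  obtain ⟨d, hd, hdC⟩ : ∃ d : ℝ, 0 < d ∧ C 1 0 = d := by
    obtain ⟨hre, him⟩ := Complex.pos_iff.1 (hs.lower_corner 1 0 (Or.inl ⟨rfl, rfl⟩))
    exact ⟨_, hre, Complex.ext rfl him.symm⟩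
  set a : ℂ := star (C 0 0) with ha_def
  have hd_sq : ‖a‖ ^ 2 + d ^ 2 = 1 := by
    rw [hdC, Complex.star_def, Complex.conj_ofReal, ha_def, mul_comm, Complex.star_def,
      Complex.mul_conj'] at hnorm
    rw [ha_def, norm_star, sq d]
    exact_mod_cast hnorm
  have ha : ‖a‖ < 1 := by nlinarith [norm_nonneg a, sq_pos_of_pos hd]
  have hρ : √(1 - ‖a‖ ^ 2) = d := by rw [← hd_sq, add_sub_cancel_left, Real.sqrt_sq hd.le]
  obtain ⟨B, hB⟩ : ∃ B : Mat (n + 1), rot n (star a) * C = bord B := by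
    refine exists_eq_bord_of_mem_unitaryGroup
      (mul_mem (rot_mem_unitaryGroup (by rw [norm_star]; exact ha.le)) hC) ?_
    rw [rot_mul_zero, norm_star, hρ, star_star, ← hnorm, hdC, Complex.star_def,
      Complex.conj_ofReal]
  refine ⟨a, ha, Bᵀ, ?_⟩
  rw [Matrix.transpose_transpose, ← hB]
  simpa using (rot_star_mul_rot_mul (a := star a) (by simpa using ha.le) C).symm

theorem mem_cmvSet_iff [NeZero n] {C : Mat n} :
    C ∈ cmvSet n ↔ C ∈ Matrix.unitaryGroup (Fin n) ℂ ∧ IsCMVShape C := by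
  obtain ⟨n, rfl⟩ := Nat.exists_eq_succ_of_ne_zero (NeZero.ne n)
  induction n with
  | zero =>
    rw [mem_cmvSet_one]
    exact (and_iff_left (by constructor <;> omega)).symm
  | succ n ih =>
    rw [mem_cmvSet_succ_succ]
    constructor
    · rintro ⟨a, ha, B, hB, rfl⟩
      rw [ih] at hB
      exact ⟨(rot_mul_bord_mem_unitaryGroup_iff ha.le).2 hB.1, hB.2.rot_mul_bord ha⟩
    · rintro ⟨hC, hs⟩
      obtain ⟨a, ha, B, rfl⟩ := exists_eq_rot_mul_bord hC hs
      rw [rot_mul_bord_mem_unitaryGroup_iff ha.le] at hC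
      exact ⟨a, ha, B, ih.2 ⟨hC, hs.of_rot_mul_bord ha⟩, rfl⟩

theorem mem_cmvSet_of_hamVec [NeZero n] {X γ : ℝ → Mat n} (hX : Continuous X)
    (hγ : IsIntegralCurve γ fun t B => hamVec (X t) B) (h₀ : γ 0 ∈ cmvSet n) (t : ℝ) :
    γ t ∈ cmvSet n := by
  rw [mem_cmvSet_iff] at *
  exact ⟨mem_unitaryGroup_of_hamVec hX hγ h₀.1 t, isCMVShape_of_hamVec hX hγ h₀.1 h₀.2 t⟩

theorem mem_eigenspace_iff {B : Mat n} {z : ℂ} {v : EuclideanSpace ℂ (Fin n)} :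
    v ∈ Module.End.eigenspace (Matrix.toEuclideanLin B) z ↔ B *ᵥ v.ofLp = z • v.ofLp := by
  rw [Module.End.mem_eigenspace_iff, Matrix.toLpLin_apply, ← (WithLp.ofLp_injective 2).eq_iff,
    WithLp.ofLp_smul]

theorem hasEigenvalue_iff {B : Mat n} {z : ℂ} :
    Module.End.HasEigenvalue (Matrix.toEuclideanLin B) z ↔ ∃ v ≠ 0, B *ᵥ v = z • v := by
  constructor
  · intro h
    obtain ⟨v, hv, hv₀⟩ := h.exists_hasEigenvector
    exact ⟨v, fun h => hv₀ (WithLp.ofLp_injective 2 h), mem_eigenspace_iff.1 hv⟩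
  · rintro ⟨v, hv₀, hv⟩
    exact Module.End.hasEigenvalue_of_hasEigenvector (x := WithLp.toLp 2 v)
      ⟨mem_eigenspace_iff.2 hv, fun h => hv₀ (congrArg WithLp.ofLp h)⟩

theorem hasEigenvalue_iff_det {B : Mat n} {z : ℂ} :
    Module.End.HasEigenvalue (Matrix.toEuclideanLin B) z ↔ (z • (1 : Mat n) - B).det = 0 := by
  rw [hasEigenvalue_iff, ← Matrix.exists_mulVec_eq_zero_iff]
  refine exists_congr fun v => and_congr_right fun _ => ?_
  rw [Matrix.sub_mulVec, Matrix.smul_mulVec, Matrix.one_mulVec, sub_eq_zero, eq_comm]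

theorem norm_pt (θ : ℝ) : ‖pt θ‖ = 1 := Complex.norm_exp_ofReal_mul_I θ

theorem pt_ne_zero (θ : ℝ) : pt θ ≠ 0 := Complex.exp_ne_zero _

theorem pt_arg {z : ℂ} (hz : ‖z‖ = 1) : pt z.arg = z := by
  simpa [pt, hz] using Complex.norm_mul_exp_arg_mul_I z

section Unitary

variable {B U : Mat n} {d : Fin n → ℂ} {v w : Fin n → ℂ} {y z : ℂ}

theorem star_mulVec_dotProduct_mulVec (hB : B ∈ Matrix.unitaryGroup (Fin n) ℂ)
    (v w : Fin n → ℂ) : star (B *ᵥ v) ⬝ᵥ (B *ᵥ w) = star v ⬝ᵥ w := by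
  rw [Matrix.star_mulVec, Matrix.dotProduct_mulVec, Matrix.vecMul_vecMul,
    ← Matrix.star_eq_conjTranspose, Matrix.mem_unitaryGroup_iff'.1 hB, Matrix.vecMul_one]

theorem star_mul_mul_dotProduct_of_mulVec (hB : B ∈ Matrix.unitaryGroup (Fin n) ℂ)
    (hv : B *ᵥ v = z • v) (hw : B *ᵥ w = y • w) :
    star z * y * (star v ⬝ᵥ w) = star v ⬝ᵥ w := by
  conv_rhs => rw [← star_mulVec_dotProduct_mulVec hB v w, hv, hw, star_smul, smul_dotProduct,
    dotProduct_smul, smul_smul, smul_eq_mul]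

theorem norm_eq_one_of_mulVec (hB : B ∈ Matrix.unitaryGroup (Fin n) ℂ) (hv₀ : v ≠ 0)
    (hv : B *ᵥ v = z • v) : ‖z‖ = 1 := by
  have h := mul_right_cancel₀ (dotProduct_star_self_eq_zero.not.2 hv₀)
    ((star_mul_mul_dotProduct_of_mulVec hB hv hv).trans (one_mul _).symm)
  rw [Complex.star_def, Complex.conj_mul'] at h
  exact (pow_eq_one_iff_of_nonneg (norm_nonneg z) two_ne_zero).1 (by exact_mod_cast h)

theorem star_dotProduct_eq_zero_of_mulVec (hB : B ∈ Matrix.unitaryGroup (Fin n) ℂ) (hzy : z ≠ y)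
    (hv : B *ᵥ v = z • v) (hw : B *ᵥ w = y • w) : star v ⬝ᵥ w = 0 := by
  rcases eq_or_ne v 0 with rfl | hv₀
  · simp
  have h := star_mul_mul_dotProduct_of_mulVec hB hv hw
  have hz : z * star z = 1 := by
    simp [Complex.mul_conj', norm_eq_one_of_mulVec hB hv₀ hv]
  refine (mul_eq_zero.1 ?_).resolve_left (sub_ne_zero.2 hzy)
  linear_combination -z * h + y * (star v ⬝ᵥ w) * hz

theorem aeval_unitary_mul_diagonal (hU : U ∈ Matrix.unitaryGroup (Fin n) ℂ) (d : Fin n → ℂ)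
    (p : ℂ[X]) : aeval (U * Matrix.diagonal d * star U) p =
      U * (Matrix.diagonal fun k => p.eval (d k)) * star U := by
  have hd : aeval d p = fun k => p.eval (d k) :=
    funext fun k => (aeval_algHom_apply (Pi.evalAlgHom ℂ (fun _ : Fin n => ℂ) k) d p).symm
  have h : aeval (Matrix.diagonal d) p = Matrix.diagonal fun k => p.eval (d k) :=
    (aeval_algHom_apply (Matrix.diagonalAlgHom ℂ) d p).trans (congrArg Matrix.diagonal hd)
  rw [← h]
  exact aeval_algHom_apply (Unitary.conjStarAlgAut ℂ (Mat n) ⟨U, hU⟩) _ p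

theorem unitary_mul_diagonal_apply_self (U : Mat n) (d : Fin n → ℂ) (i : Fin n) :
    (U * Matrix.diagonal d * star U) i i = ∑ k, d k * (‖U i k‖ ^ 2 : ℝ) := by
  rw [Matrix.mul_apply]
  refine Finset.sum_congr rfl fun k _ => ?_
  rw [Matrix.mul_diagonal, Matrix.star_apply, mul_right_comm, Complex.star_def,
    Complex.mul_conj', mul_comm, Complex.ofReal_pow]

theorem smul_one_sub_unitary_mul_diagonal (hU : U ∈ Matrix.unitaryGroup (Fin n) ℂ)
    (d : Fin n → ℂ) (w : ℂ) : w • 1 - U * Matrix.diagonal d * star U =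
      U * (Matrix.diagonal fun k => w - d k) * star U := by
  have h := aeval_unitary_mul_diagonal hU d (C w - X)
  simp only [map_sub, aeval_C, aeval_X, eval_sub, eval_C, eval_X] at h
  rwa [Algebra.algebraMap_eq_smul_one] at h

theorem det_unitary_mul_mul_star (hU : U ∈ Matrix.unitaryGroup (Fin n) ℂ) (A : Mat n) :
    (U * A * star U).det = A.det := by
  rw [Matrix.det_mul_comm, ← Matrix.mul_assoc, Matrix.mem_unitaryGroup_iff'.1 hU, Matrix.one_mul]

end Unitary

section SimpleSpectrum

variable {B U : Mat n} {ϑ : Fin n → ℝ}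

theorem exists_unit_eigenvector {z : ℂ}
    (hz : Module.End.HasEigenvalue (Matrix.toEuclideanLin B) z) :
    ∃ u, star u ⬝ᵥ u = 1 ∧ B *ᵥ u = z • u := by
  obtain ⟨v, hv⟩ := hz.exists_hasEigenvector
  have hr : (‖v‖ : ℂ) ≠ 0 := by simpa using hv.2
  refine ⟨(‖v‖ : ℂ)⁻¹ • v.ofLp, ?_, ?_⟩
  · have h : star v.ofLp ⬝ᵥ v.ofLp = (‖v‖ : ℂ) ^ 2 := by
      rw [dotProduct_comm, ← EuclideanSpace.inner_eq_star_dotProduct, inner_self_eq_norm_sq_to_K]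
      rfl
    rw [star_smul, smul_dotProduct, dotProduct_smul, h]
    simp [sq, hr]
  · rw [Matrix.mulVec_smul, mem_eigenspace_iff.1 hv.1, smul_comm]

theorem IsSpectrum.exists_diagonalization (hϑ : IsSpectrum B ϑ)
    (hB : B ∈ Matrix.unitaryGroup (Fin n) ℂ) :
    ∃ U ∈ Matrix.unitaryGroup (Fin n) ℂ,
      B = U * (Matrix.diagonal fun j => pt (ϑ j)) * star U := by
  choose u hu hBu using fun j => exists_unit_eigenvector (hϑ.2 j)
  set U : Mat n := Matrix.of fun i j => u j i
  have hU : star U * U = 1 := by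
    ext j k
    rcases eq_or_ne j k with rfl | hjk
    · rw [Matrix.one_apply_eq]
      exact hu j
    · rw [Matrix.one_apply_ne hjk]
      exact star_dotProduct_eq_zero_of_mulVec hB (fun h => hjk (hϑ.1 h)) (hBu j) (hBu k)
  have hBU : B * U = U * Matrix.diagonal fun j => pt (ϑ j) := by
    ext i j
    rw [Matrix.mul_diagonal, mul_comm]
    exact congrFun (hBu j) i
  refine ⟨U, Matrix.mem_unitaryGroup_iff'.2 hU, ?_⟩
  rw [← hBU, Matrix.mul_assoc, mul_eq_one_comm.1 hU, Matrix.mul_one]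

theorem mulVec_col_of_diagonalization {d : Fin n → ℂ} (hU : U ∈ Matrix.unitaryGroup (Fin n) ℂ)
    (j : Fin n) : (U * Matrix.diagonal d * star U) *ᵥ U.col j = d j • U.col j := by
  have h : U * Matrix.diagonal d * star U * U = U * Matrix.diagonal d := by
    rw [Matrix.mul_assoc, Matrix.mem_unitaryGroup_iff'.1 hU, Matrix.mul_one]
  ext i
  refine (congrFun (congrFun h i) j).trans ?_
  rw [Matrix.mul_diagonal, mul_comm]
  rfl

theorem eigenspace_eq_span_col {d : Fin n → ℂ} (hd : Function.Injective d)
    (hU : U ∈ Matrix.unitaryGroup (Fin n) ℂ) (j : Fin n) :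
    Module.End.eigenspace (Matrix.toEuclideanLin (U * Matrix.diagonal d * star U)) (d j) =
      ℂ ∙ WithLp.toLp 2 (U.col j) := by
  refine le_antisymm (fun v hv => ?_) ?_
  · rw [mem_eigenspace_iff] at hv
    set w := star U *ᵥ v.ofLp with hw
    have hvw : v.ofLp = U *ᵥ w := by
      rw [hw, Matrix.mulVec_mulVec, Matrix.mem_unitaryGroup_iff.1 hU, Matrix.one_mulVec]
    have hdw : Matrix.diagonal d *ᵥ w = d j • w := by
      rw [hw, ← Matrix.mulVec_smul, ← hv, Matrix.mulVec_mulVec, Matrix.mulVec_mulVec,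
        ← Matrix.mul_assoc, ← Matrix.mul_assoc, Matrix.mem_unitaryGroup_iff'.1 hU, Matrix.one_mul]
    have hw₀ (k : Fin n) (hk : k ≠ j) : w k = 0 := by
      have h := congrFun hdw k
      rw [Matrix.mulVec_diagonal, Pi.smul_apply, smul_eq_mul] at h
      exact (mul_eq_mul_right_iff.1 h).resolve_left (hd.ne hk)
    refine Submodule.mem_span_singleton.2 ⟨w j, WithLp.ofLp_injective 2 ?_⟩
    rw [WithLp.ofLp_smul, hvw]
    ext i
    rw [Matrix.mulVec, dotProduct, Finset.sum_eq_single j (fun k _ hk => by rw [hw₀ k hk, mul_zero])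
      (by simp)]
    exact mul_comm _ _
  · rw [Submodule.span_singleton_le_iff_mem, mem_eigenspace_iff]
    exact mulVec_col_of_diagonalization hU j

theorem mass_of_diagonalization [NeZero n] {d : Fin n → ℂ} (hd : Function.Injective d)
    (hU : U ∈ Matrix.unitaryGroup (Fin n) ℂ) (j : Fin n) :
    mass (U * Matrix.diagonal d * star U) (d j) = ‖U 0 j‖ ^ 2 := by
  set u : EuclideanSpace ℂ (Fin n) := WithLp.toLp 2 (U.col j) with hu
  have hnorm : ‖u‖ = 1 := by
    have h : star (U.col j) ⬝ᵥ U.col j = 1 :=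
      (congrFun (congrFun (Matrix.mem_unitaryGroup_iff'.1 hU) j) j).trans (Matrix.one_apply_eq j)
    rw [dotProduct_comm] at h
    have h' : inner ℂ u u = (1 : ℂ) := h
    rw [inner_self_eq_norm_sq_to_K] at h'
    exact (pow_eq_one_iff_of_nonneg (norm_nonneg u) two_ne_zero).1 
      (Complex.ofReal_injective (by simpa using h'))
  have hproj (S : Submodule ℂ (EuclideanSpace ℂ (Fin n))) [S.HasOrthogonalProjection]
      (hS : S = ℂ ∙ u) (x : EuclideanSpace ℂ (Fin n)) : S.starProjection x = inner ℂ u x • u := by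
    subst hS
    exact Submodule.starProjection_unit_singleton ℂ hnorm x
  rw [mass, hproj _ (eigenspace_eq_span_col hd hU j), norm_smul, hnorm, mul_one,
    EuclideanSpace.inner_single_right]
  simp [hu]

variable (hϑ : IsSpectrum B ϑ) (hB : B ∈ Matrix.unitaryGroup (Fin n) ℂ)
include hϑ hB

theorem IsSpectrum.trace_aeval (p : ℂ[X]) : (aeval B p).trace = ∑ k, p.eval (pt (ϑ k)) := by
  obtain ⟨U, hU, rfl⟩ := hϑ.exists_diagonalization hB
  rw [aeval_unitary_mul_diagonal hU, Matrix.trace_mul_comm, ← Matrix.mul_assoc,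
    Matrix.mem_unitaryGroup_iff'.1 hU, Matrix.one_mul, Matrix.trace_diagonal]

theorem IsSpectrum.aeval_apply_zero_zero [NeZero n] (p : ℂ[X]) :
    aeval B p 0 0 = ∑ k, p.eval (pt (ϑ k)) * mass B (pt (ϑ k)) := by
  obtain ⟨U, hU, rfl⟩ := hϑ.exists_diagonalization hB
  simp only [aeval_unitary_mul_diagonal hU, unitary_mul_diagonal_apply_self,
    mass_of_diagonalization hϑ.1 hU]

theorem IsSpectrum.sum_mass [NeZero n] : ∑ k, mass B (pt (ϑ k)) = 1 := by
  have h := hϑ.aeval_apply_zero_zero hB 1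
  simp only [map_one, Matrix.one_apply_eq, eval_one, one_mul] at h
  exact_mod_cast h.symm

theorem IsSpectrum.aeval_eq_zero_iff {p : ℂ[X]} :
    aeval B p = 0 ↔ ∀ k, p.eval (pt (ϑ k)) = 0 := by
  obtain ⟨U, hU, rfl⟩ := hϑ.exists_diagonalization hB
  rw [aeval_unitary_mul_diagonal hU]
  refine (map_eq_zero_iff (Unitary.conjStarAlgAut ℂ (Mat n) ⟨U, hU⟩)
    (EquivLike.injective _)).trans ?_
  rw [Matrix.diagonal_eq_zero, funext_iff]
  rfl

theorem IsSpectrum.conjTranspose_aeval {p : ℂ[X]}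
    (hp : ∀ k, star (p.eval (pt (ϑ k))) = p.eval (pt (ϑ k))) : (aeval B p)ᴴ = aeval B p := by
  obtain ⟨U, hU, rfl⟩ := hϑ.exists_diagonalization hB
  rw [aeval_unitary_mul_diagonal hU, ← Matrix.star_eq_conjTranspose, star_mul, star_mul, star_star,
    Matrix.star_eq_conjTranspose (Matrix.diagonal _), Matrix.diagonal_conjTranspose,
    Matrix.mul_assoc]
  exact congrArg (fun d => U * (Matrix.diagonal d * star U)) (funext hp)

theorem IsSpectrum.det_smul_one_sub (w : ℂ) :
    (w • (1 : Mat n) - B).det = ∏ k, (w - pt (ϑ k)) := by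
  obtain ⟨U, hU, rfl⟩ := hϑ.exists_diagonalization hB
  rw [smul_one_sub_unitary_mul_diagonal hU, det_unitary_mul_mul_star hU, Matrix.det_diagonal]

theorem IsSpectrum.exists_eq_pt {z : ℂ}
    (hz : Module.End.HasEigenvalue (Matrix.toEuclideanLin B) z) : ∃ k, z = pt (ϑ k) := by
  rw [hasEigenvalue_iff_det, hϑ.det_smul_one_sub hB, Finset.prod_eq_zero_iff] at hz
  obtain ⟨k, -, hk⟩ := hz
  exact ⟨k, sub_eq_zero.1 hk⟩

end SimpleSpectrum

section Cyclic

theorem apply_eq_zero_of_mulVec {A : Mat n} {v : Fin n → ℂ} {z : ℂ} {m q : Fin n}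
    (hv : A *ᵥ v = z • v) (hqm : q < m) (hA : A q m ≠ 0) (hA' : ∀ k, m < k → A q k = 0)
    (hlt : ∀ k < m, v k = 0) : v m = 0 := by
  have h := congrFun hv q
  rw [Pi.smul_apply, hlt q hqm, smul_zero, Matrix.mulVec, dotProduct,
    Finset.sum_eq_single m (fun k _ hk => ?_) (by simp)] at h
  · exact (mul_eq_zero.1 h).resolve_left hA
  · rcases lt_or_gt_of_ne hk with hk | hk
    · rw [hlt k hk, mul_zero]
    · rw [hA' k hk, zero_mul]

variable [NeZero n] {B C : Mat n} {v : Fin n → ℂ} {w z : ℂ}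

theorem IsCMVShape.eq_zero_of_apply_zero (hs : IsCMVShape B) (hv : B *ᵥ v = z • v)
    (hv' : Bᴴ *ᵥ v = w • v) (h₀ : v 0 = 0) : v = 0 := by
  ext m
  induction m using WellFoundedLT.induction with
  | ind m ih =>
    rcases Nat.eq_zero_or_pos m with hm₀ | hm₀
    · rwa [show m = 0 from Fin.ext hm₀]
    rcases Nat.mod_two_eq_zero_or_one m with hm | hm
    · obtain ⟨q, hq⟩ : ∃ q : Fin n, (m : ℕ) = q + 2 := 
        ⟨⟨m - 2, by omega⟩, by dsimp only; omega⟩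
      exact apply_eq_zero_of_mulVec hv (Fin.lt_def.2 (by omega))
        (hs.upper_corner q m (by omega) hq).ne'
        (fun k hk => hs.upper q k (by rw [Fin.lt_def] at hk; omega)) ih
    · obtain ⟨q, hq⟩ : ∃ q : Fin n,
          (m : ℕ) = 1 ∧ (q : ℕ) = 0 ∨ (q : ℕ) % 2 = 1 ∧ (m : ℕ) = q + 2 := by
        by_cases h : (m : ℕ) = 1
        · exact ⟨0, Or.inl ⟨h, rfl⟩⟩
        · exact ⟨⟨m - 2, by omega⟩, Or.inr (by dsimp only; omega)⟩
      refine apply_eq_zero_of_mulVec (q := q) hv' (Fin.lt_def.2 (by omega)) ?_ (fun k hk => ?_) ih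
      · exact star_ne_zero.2 (hs.lower_corner m q hq).ne'
      · rw [Matrix.conjTranspose_apply, hs.lower k q (by omega), star_zero]

theorem apply_zero_ne_zero_of_mem_cmvSet (hC : C ∈ cmvSet n) (hv₀ : v ≠ 0)
    (hv : C *ᵥ v = z • v) : v 0 ≠ 0 := by
  obtain ⟨hu, hs⟩ := mem_cmvSet_iff.1 hC
  have hz : z ≠ 0 := norm_ne_zero_iff.1 (by simp [norm_eq_one_of_mulVec hu hv₀ hv])
  refine fun h₀ => hv₀ (hs.eq_zero_of_apply_zero hv (w := z⁻¹) ?_ h₀)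
  rw [eq_inv_smul_iff₀ hz, ← Matrix.mulVec_smul, ← hv, Matrix.mulVec_mulVec,
    ← Matrix.star_eq_conjTranspose, Matrix.mem_unitaryGroup_iff'.1 hu, Matrix.one_mulVec]

theorem mass_pos (hC : C ∈ cmvSet n) {ϑ : Fin n → ℝ} (hϑ : IsSpectrum C ϑ) (j : Fin n) :
    0 < mass C (pt (ϑ j)) := by
  obtain ⟨U, hU, rfl⟩ := hϑ.exists_diagonalization (mem_cmvSet_iff.1 hC).1
  rw [mass_of_diagonalization hϑ.1 hU]
  have hcol : U.col j ≠ 0 := fun h => one_ne_zero <| calc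
    (1 : ℂ) = (star U * U) j j := by rw [Matrix.mem_unitaryGroup_iff'.1 hU, Matrix.one_apply_eq]
    _ = star (U.col j) ⬝ᵥ U.col j := rfl
    _ = 0 := by rw [h, dotProduct_zero]
  have h : U 0 j ≠ 0 :=
    apply_zero_ne_zero_of_mem_cmvSet hC hcol (mulVec_col_of_diagonalization hU j)
  positivity

theorem isSemisimple_of_linearIsometry {E : Type*} [NormedAddCommGroup E] [InnerProductSpace ℂ E]
    [FiniteDimensional ℂ E] (T : E →ₗᵢ[ℂ] E) : Module.End.IsSemisimple T.toLinearMap := by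
  refine Module.End.isSemisimple_iff.2 fun p hp => ⟨pᗮ, ?_, Submodule.isCompl_orthogonal p⟩
  have hp' : p.map T.toLinearMap = p :=
    Submodule.eq_of_le_of_finrank_eq (Submodule.map_le_iff_le_comap.2 hp)
      (Submodule.equivMapOfInjective _ T.injective p).finrank_eq.symm
  intro x hx
  rw [Submodule.mem_comap, Submodule.mem_orthogonal, ← hp']
  rintro _ ⟨y, hy, rfl⟩
  exact (T.inner_map_map y x).trans ((Submodule.mem_orthogonal _ _).1 hx y hy)

theorem card_eigenvalues_of_isSemisimple {E : Type*} [AddCommGroup E] [Module ℂ E]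
    [FiniteDimensional ℂ E] {T : Module.End ℂ E} (hT : T.IsSemisimple)
    (hT' : ∀ z, Module.finrank ℂ (T.eigenspace z) ≤ 1) :
    Nat.card T.Eigenvalues = Module.finrank ℂ E := by
  choose v hv using fun z : T.Eigenvalues => 
    Module.End.HasEigenvalue.exists_hasEigenvector (f := T) z.property
  have hli := T.eigenvectors_linearIndependent' _ Subtype.val_injective v hv
  have hspan : ⊤ ≤ Submodule.span ℂ (Set.range v) := by
    rw [← hT.iSup_eigenspace_eq_top]
    refine iSup_le fun z x hx => ?_
    rcases eq_or_ne x 0 with rfl | hx₀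
    · exact zero_mem _
    have hz : T.HasEigenvalue z := Module.End.hasEigenvalue_of_hasEigenvector ⟨hx, hx₀⟩
    let u : T.Eigenvalues := ⟨z, hz⟩
    have hvu : (⟨v u, (hv u).1⟩ : T.eigenspace z) ≠ 0 := fun h => (hv u).2 (congrArg Subtype.val h)
    obtain ⟨c, hc⟩ := exists_smul_eq_of_finrank_eq_one
      (le_antisymm (hT' z) (Module.finrank_pos_iff_exists_ne_zero.2 ⟨_, hvu⟩)) hvu ⟨x, hx⟩
    rw [show x = c • v u from (congrArg Subtype.val hc).symm]
    exact Submodule.smul_mem _ c (Submodule.subset_span ⟨u, rfl⟩)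
  exact (Module.finrank_eq_nat_card_basis (Module.Basis.mk hli hspan)).symm

theorem finrank_eigenspace_le_one (hC : C ∈ cmvSet n) (z : ℂ) :
    Module.finrank ℂ (Module.End.eigenspace (Matrix.toEuclideanLin C) z) ≤ 1 := by
  rw [← Module.finrank_self ℂ]
  refine LinearMap.finrank_le_finrank_of_injective
    (f := (EuclideanSpace.proj (0 : Fin n)).toLinearMap ∘ₗ Submodule.subtype _) ?_
  refine (injective_iff_map_eq_zero _).2 fun v hv => ?_
  by_contra hv₀
  exact apply_zero_ne_zero_of_mem_cmvSet hC (fun h => hv₀ (Subtype.ext (WithLp.ofLp_injective 2 h)))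
    (mem_eigenspace_iff.1 v.2) hv

theorem exists_isSpectrum (hC : C ∈ cmvSet n) : ∃ ϑ : Fin n → ℝ, IsSpectrum C ϑ := by
  have hu := (mem_cmvSet_iff.1 hC).1
  set T := Matrix.toEuclideanLin C with hT
  have hss : Module.End.IsSemisimple T :=
    isSemisimple_of_linearIsometry (T.isometryOfInner fun v w => by
      simp only [hT, Matrix.toLpLin_apply, EuclideanSpace.inner_eq_star_dotProduct]
      rw [dotProduct_comm, star_mulVec_dotProduct_mulVec hu, dotProduct_comm])
  have hcard : Nat.card (Fin n) = Nat.card (Module.End.Eigenvalues T) := by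
    rw [card_eigenvalues_of_isSemisimple hss (finrank_eigenspace_le_one hC),
      finrank_euclideanSpace_fin, Nat.card_fin]
  obtain ⟨e⟩ := Finite.card_eq.1 hcard
  have hpt (j : Fin n) : pt (e j : ℂ).arg = e j := by
    obtain ⟨v, hv₀, hv⟩ := hasEigenvalue_iff.1 (e j).property
    exact pt_arg (norm_eq_one_of_mulVec hu hv₀ hv)
  refine ⟨fun j => (e j : ℂ).arg, fun j k hjk => ?_, fun j => ?_⟩
  · simp only [hpt] at hjk
    exact e.injective (Subtype.ext hjk)
  · rw [hpt]
    exact (e j).property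

end Cyclic

section Hamiltonian

variable {γ : ℝ → Mat n} {D : Mat n} {t : ℝ}

theorem hasDerivAt_matrix_pow (hγ : HasDerivAt γ D t) (m : ℕ) :
    HasDerivAt (fun s => γ s ^ m) (∑ i ∈ Finset.range m, γ t ^ i * D * γ t ^ (m - 1 - i)) t := by
  induction m with
  | zero => simpa using! hasDerivAt_const t (1 : Mat n)
  | succ m ih =>
    simp only [pow_succ]
    refine (hasDerivAt_matrix_mul ih hγ).congr_deriv ?_
    rw [Finset.sum_range_succ, Finset.sum_mul]
    refine congrArg₂ _ (Finset.sum_congr rfl fun i hi => ?_) (by simp)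
    rw [Finset.mem_range] at hi
    rw [Matrix.mul_assoc _ _ (γ t), ← pow_succ]
    congr 2
    omega

theorem hasDerivAt_trace (hγ : HasDerivAt γ D t) : HasDerivAt (fun s => (γ s).trace) D.trace t :=
  HasDerivAt.fun_sum fun i _ => hasDerivAt_matrix.1 hγ i i

theorem hasDerivAt_trace_pow (hγ : HasDerivAt γ D t) (m : ℕ) :
    HasDerivAt (fun s => (γ s ^ m).trace) (m * (γ t ^ (m - 1) * D).trace) t := by
  refine (hasDerivAt_trace (hasDerivAt_matrix_pow hγ m)).congr_deriv ?_
  have h : ∀ i ∈ Finset.range m,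
      (γ t ^ i * D * γ t ^ (m - 1 - i)).trace = (γ t ^ (m - 1) * D).trace := fun i hi => by
    rw [Finset.mem_range] at hi
    rw [Matrix.trace_mul_cycle, ← pow_add]
    congr 3
    omega
  rw [Matrix.trace_sum, Finset.sum_congr rfl h, Finset.sum_const, Finset.card_range, nsmul_eq_mul]

theorem hasDerivAt_trace_aeval (hγ : HasDerivAt γ D t) (p : ℂ[X]) :
    HasDerivAt (fun s => (aeval (γ s) p).trace) (aeval (γ t) p.derivative * D).trace t := by
  induction p using Polynomial.induction_on' with
  | add p q hp hq =>
    simp only [map_add, add_mul, Matrix.trace_add]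
    exact hp.fun_add hq
  | monomial m a =>
    simp only [derivative_monomial, aeval_monomial, Algebra.algebraMap_eq_smul_one, smul_mul_assoc,
      one_mul, Matrix.trace_smul, smul_eq_mul, mul_assoc]
    exact (hasDerivAt_trace_pow hγ m).const_mul a

theorem contDiff_hamiltonian {k : WithTop ℕ∞} (f : ℂ[X]) :
    ContDiff ℝ k (hamiltonian f : Mat n → ℝ) :=
  Complex.imCLM.contDiff.comp <| ContDiff.sum fun i _ =>
    contDiff_pi.1 (contDiff_pi.1 (contDiff_aeval f) i) i

theorem fderiv_hamiltonian (f : ℂ[X]) (B V : Mat n) :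
    fderiv ℝ (hamiltonian f) B V = pairing (aeval B f.derivative) V := by
  have hγ : HasDerivAt (fun s : ℝ => B + s • V) V 0 := by
    simpa only [one_smul] using! ((hasDerivAt_id (0 : ℝ)).smul_const V).const_add B
  have h := ((contDiff_hamiltonian (k := 1) f).differentiable one_ne_zero _).hasFDerivAt
    |>.comp_hasDerivAt (0 : ℝ) hγ
  have h' := h.unique (Complex.imCLM.hasFDerivAt.comp_hasDerivAt (0 : ℝ)
    (hasDerivAt_trace_aeval hγ f))
  simpa using! h'

theorem grad_eq_of_fderiv {φ : Mat n → ℝ} {B X : Mat n}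
    (h : ∀ V, fderiv ℝ φ B V = pairing X V) : grad φ B = X := by
  ext k l
  rw [grad, Matrix.of_apply, h, h, pairing, pairing, Matrix.trace_mul_single,
    Matrix.trace_mul_single]
  apply Complex.ext <;> simp

theorem grad_hamiltonian (f : ℂ[X]) (B : Mat n) :
    grad (hamiltonian f) B = aeval B f.derivative :=
  grad_eq_of_fderiv (fderiv_hamiltonian f B)

theorem isHamiltonianCurve_iff {φ : Mat n → ℝ} :
    IsHamiltonianCurve φ γ ↔ IsIntegralCurve γ fun _ B => hamVec (grad φ B) B := by
  constructor
  · intro h t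
    let e := (Module.finBasis ℝ (Mat n)).equivFunL
    have he : HasDerivAt (fun s => e (γ s)) (e (hamVec (grad φ (γ t)) (γ t))) t := by
      refine hasDerivAt_pi.2 fun i => ?_
      let ℓ : Mat n →L[ℝ] ℝ := (ContinuousLinearMap.proj i).comp e.toContinuousLinearMap
      have hℓ := h ℓ ℓ.contDiff t
      rwa [gdBracket_eq_fderiv, ℓ.fderiv] at hℓ
    refine ((e.symm.hasFDerivAt.comp_hasDerivAt t he).congr_deriv (e.symm_apply_apply _))
      |>.congr_of_eventuallyEq (.of_forall fun s => (e.symm_apply_apply (γ s)).symm)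
  · intro h ψ hψ t
    rw [gdBracket_eq_fderiv]
    exact (hψ.differentiable (by simp) _).hasFDerivAt.comp_hasDerivAt t (h t)

end Hamiltonian

section Lax

variable {B : Mat n} {ϑ : Fin n → ℝ}

theorem hasDerivAt_aeval_of_lax {γ : ℝ → Mat n} {A : Mat n} {t : ℝ}
    (hγ : HasDerivAt γ (A * γ t - γ t * A) t) (p : ℂ[X]) :
    HasDerivAt (fun s => aeval (γ s) p) (A * aeval (γ t) p - aeval (γ t) p * A) t := by
  induction p using Polynomial.induction_on with
  | C a =>
    simp only [aeval_C, Algebra.commutes a A, sub_self]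
    exact hasDerivAt_const t _
  | add p q hp hq =>
    simp only [map_add]
    refine (hp.add hq).congr_deriv ?_
    noncomm_ring
  | monomial m a h =>
    simp only [pow_succ, ← mul_assoc, map_mul, aeval_X] at h ⊢
    refine (hasDerivAt_matrix_mul h hγ).congr_deriv ?_
    noncomm_ring

theorem IsSpectrum.of_aeval_eq_zero [NeZero n] {ϑ' : Fin n → ℝ} (hϑ' : IsSpectrum B ϑ')
    (hB : B ∈ Matrix.unitaryGroup (Fin n) ℂ) (hϑ : Function.Injective fun j => pt (ϑ j))
    (h : aeval B (∏ k, (X - C (pt (ϑ k)))) = 0) : IsSpectrum B ϑ := by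
  have hmem (k : Fin n) : ∃ l, pt (ϑ' k) = pt (ϑ l) := by
    have hk := (hϑ'.aeval_eq_zero_iff hB).1 h k
    rw [eval_prod, Finset.prod_eq_zero_iff] at hk
    obtain ⟨l, -, hl⟩ := hk
    exact ⟨l, by simpa [sub_eq_zero] using hl⟩
  choose σ hσ using hmem
  have hσ_inj : Function.Injective σ := fun k l hkl => hϑ'.1 (by simp only [hσ, hkl])
  refine ⟨hϑ, fun j => ?_⟩
  obtain ⟨k, rfl⟩ := Finite.surjective_of_injective hσ_inj j
  rw [← hσ]
  exact hϑ'.2 k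

theorem re_commutator_piA_apply_zero_zero [NeZero n] (Z : Mat n) {P : Mat n} (hP : Pᴴ = P) :
    ((piA Z * P - P * piA Z) 0 0).re =
      2 * ((Z * P) 0 0).re - 2 * (Z 0 0).re * (P 0 0).re := by
  have hrow (k : Fin n) : piA Z 0 k = Z 0 k - if k = 0 then ((Z 0 0).re : ℂ) else 0 := by
    rcases eq_or_ne k 0 with rfl | hk
    · apply Complex.ext <;> simp [piA]
    · simp [piA, hk, Fin.pos_iff_ne_zero]
  have hAP : (piA Z * P) 0 0 = (Z * P) 0 0 - (Z 0 0).re * P 0 0 := by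
    simp only [Matrix.mul_apply, hrow, sub_mul, ite_mul, zero_mul, Finset.sum_sub_distrib]
    simp
  have hPA : (P * piA Z) 0 0 = -star ((piA Z * P) 0 0) := by
    rw [← Matrix.conjTranspose_apply, Matrix.conjTranspose_mul, hP, piA_conjTranspose, mul_neg,
      Matrix.neg_apply, neg_neg]
  rw [Matrix.sub_apply, hPA, hAP]
  simp only [Complex.sub_re, Complex.neg_re, Complex.star_def, Complex.conj_re,
    Complex.re_ofReal_mul]
  ring

theorem eval_lagrangeBasis {K : Type*} [Field K] {v : Fin n → K} (hv : Function.Injective v)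
    (j k : Fin n) :
    (Lagrange.basis Finset.univ v j).eval (v k) = if k = j then 1 else 0 := by
  split_ifs with h
  · rw [h, Lagrange.eval_basis_self hv.injOn (Finset.mem_univ j)]
  · exact Lagrange.eval_basis_of_ne (Ne.symm h) (Finset.mem_univ k)

variable [NeZero n] (hϑ : IsSpectrum B ϑ) (hB : B ∈ Matrix.unitaryGroup (Fin n) ℂ)
include hϑ hB

theorem IsSpectrum.aeval_mul_lagrangeBasis_apply_zero_zero (p : ℂ[X]) (j : Fin n) :
    aeval B (p * Lagrange.basis Finset.univ (fun k => pt (ϑ k)) j) 0 0 =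
      p.eval (pt (ϑ j)) * mass B (pt (ϑ j)) := by
  rw [hϑ.aeval_apply_zero_zero hB]
  simp [eval_lagrangeBasis hϑ.1]

theorem IsSpectrum.re_aeval_lagrangeBasis_apply_zero_zero (j : Fin n) :
    (aeval B (Lagrange.basis Finset.univ (fun k => pt (ϑ k)) j) 0 0).re =
      mass B (pt (ϑ j)) := by
  simpa using congrArg Complex.re (hϑ.aeval_mul_lagrangeBasis_apply_zero_zero hB 1 j)

theorem IsSpectrum.two_mul_re_aeval_apply_zero_zero (f : ℂ[X]) :
    2 * (aeval B (X * f.derivative) 0 0).re =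
      ∑ k, bigF f (pt (ϑ k)) * mass B (pt (ϑ k)) := by
  rw [hϑ.aeval_apply_zero_zero hB, Complex.re_sum, Finset.mul_sum]
  refine Finset.sum_congr rfl fun k _ => ?_
  rw [Complex.re_mul_ofReal, ← mul_assoc, eval_mul, eval_X, bigF]

end Lax

section Flow

variable {φ : Mat n → ℝ} {f : ℂ[X]} {γ : ℝ → Mat n} {ϑ : Fin n → ℝ}

theorem IsHamiltonianCurve.mem_cmvSet [NeZero n] (hγ : IsHamiltonianCurve φ γ)
    (hφ : Continuous (grad φ)) (h₀ : γ 0 ∈ cmvSet n) (t : ℝ) : γ t ∈ cmvSet n :=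
  have hγ' := isHamiltonianCurve_iff.1 hγ
  mem_cmvSet_of_hamVec (hφ.comp hγ'.continuous) (fun s => hγ' s) h₀ t

theorem continuous_grad_hamiltonian (f : ℂ[X]) : Continuous (grad (hamiltonian f : Mat n → ℝ)) := by
  rw [funext (grad_hamiltonian f)]
  exact (contDiff_aeval (k := 0) _).continuous

theorem IsHamiltonianCurve.hasDerivAt_aeval (hγ : IsHamiltonianCurve (hamiltonian f) γ) (p : ℂ[X])
    (t : ℝ) : HasDerivAt (fun s => aeval (γ s) p)
      (piA (aeval (γ t) (X * f.derivative)) * aeval (γ t) p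
        - aeval (γ t) p * piA (aeval (γ t) (X * f.derivative))) t := by
  refine hasDerivAt_aeval_of_lax ((isHamiltonianCurve_iff.1 hγ t).congr_deriv ?_) p
  have hcomm : Commute (aeval (γ t) f.derivative) (γ t) := by
    simpa using (Commute.all f.derivative X).map (aeval (γ t))
  simp only [grad_hamiltonian, hamVec_of_commute hcomm, map_mul, aeval_X]

variable [NeZero n] (hγ : IsHamiltonianCurve (hamiltonian f) γ) (h₀ : γ 0 ∈ cmvSet n)
  (hϑ : IsSpectrum (γ 0) ϑ)
include hγ h₀ hϑ

theorem IsHamiltonianCurve.isSpectrum (t : ℝ) : IsSpectrum (γ t) ϑ := by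
  have hmem := hγ.mem_cmvSet (continuous_grad_hamiltonian f) h₀
  obtain ⟨ϑ', hϑ'⟩ := exists_isSpectrum (hmem t)
  refine hϑ'.of_aeval_eq_zero (mem_cmvSet_iff.1 (hmem t)).1 hϑ.1 ?_
  have hA : Continuous fun t => piA (aeval (γ t) (X * f.derivative)) :=
    continuous_piA.comp ((contDiff_aeval (k := 0) _).continuous.comp
      (isHamiltonianCurve_iff.1 hγ).continuous)
  refine eq_zero_of_isIntegralCurve_linear
    (A := fun t => LinearMap.mulLeft ℝ (piA (aeval (γ t) (X * f.derivative)))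
      - LinearMap.mulRight ℝ (piA (aeval (γ t) (X * f.derivative))))
    (w := fun t => aeval (γ t) (∏ k, (X - C (pt (ϑ k)))))
    (fun W => (hA.matrix_mul continuous_const).sub (continuous_const.matrix_mul hA))
    (fun s => hγ.hasDerivAt_aeval _ s) ?_ t
  refine (hϑ.aeval_eq_zero_iff (mem_cmvSet_iff.1 h₀).1).2 fun k => ?_
  rw [eval_prod]
  exact Finset.prod_eq_zero (Finset.mem_univ k) (by simp)

theorem IsHamiltonianCurve.hasDerivAt_mass (j : Fin n) (t : ℝ) :
    HasDerivAt (fun s => mass (γ s) (pt (ϑ j)))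
      ((bigF f (pt (ϑ j)) - ∑ l, bigF f (pt (ϑ l)) * mass (γ t) (pt (ϑ l)))
        * mass (γ t) (pt (ϑ j))) t := by
  have hu (s : ℝ) := (mem_cmvSet_iff.1 (hγ.mem_cmvSet (continuous_grad_hamiltonian f) h₀ s)).1
  have hsp := hγ.isSpectrum h₀ hϑ
  set p := Lagrange.basis Finset.univ (fun k => pt (ϑ k)) j with hp
  have hP : (aeval (γ t) p)ᴴ = aeval (γ t) p := (hsp t).conjTranspose_aeval (hu t) fun k => by
    rw [hp, eval_lagrangeBasis hϑ.1]
    split_ifs <;> simp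
  simp only [← fun s => (hsp s).re_aeval_lagrangeBasis_apply_zero_zero (hu s) j]
  refine (Complex.reCLM.hasFDerivAt.comp_hasDerivAt t
    (hasDerivAt_matrix.1 (hγ.hasDerivAt_aeval p t) 0 0)).congr_deriv ?_
  rw [Complex.reCLM_apply, re_commutator_piA_apply_zero_zero _ hP, ← map_mul,
    (hsp t).aeval_mul_lagrangeBasis_apply_zero_zero (hu t), Complex.re_mul_ofReal, ← mul_assoc,
    (hsp t).two_mul_re_aeval_apply_zero_zero (hu t), sub_mul, hp,
    (hsp t).re_aeval_lagrangeBasis_apply_zero_zero (hu t), eval_mul, eval_X, bigF]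

theorem IsHamiltonianCurve.hasDerivAt_log_mass (j : Fin n) (t : ℝ) :
    HasDerivAt (fun s => Real.log (mass (γ s) (pt (ϑ j))))
      (bigF f (pt (ϑ j)) - ∑ l, bigF f (pt (ϑ l)) * mass (γ t) (pt (ϑ l))) t := by
  have hpos := mass_pos (hγ.mem_cmvSet (continuous_grad_hamiltonian f) h₀ t)
    (hγ.isSpectrum h₀ hϑ t) j
  refine ((hγ.hasDerivAt_mass h₀ hϑ j t).log hpos.ne').congr_deriv ?_
  rw [mul_div_cancel_right₀ _ hpos.ne']

end Flow

theorem eq_exp_mul_div_sum_of_sum_eq_one {ι : Type*} [Fintype ι] {μ : ℝ → ι → ℝ} {F : ι → ℝ}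
    (hsum : ∀ t, ∑ j, μ t j = 1)
    (hμ : ∀ j, IsIntegralCurve (fun t => μ t j) fun t x => (F j - ∑ l, F l * μ t l) • x)
    (t : ℝ) (j : ι) :
    μ t j = Real.exp (F j * t) * μ 0 j / ∑ l, Real.exp (F l * t) * μ 0 l := by
  have hc : Continuous fun t => ∑ l, F l * μ t l :=
    continuous_finsetSum _ fun l _ => continuous_const.mul (hμ l).continuous
  set S := ∫ s in (0 : ℝ)..t, ∑ l, F l * μ s l
  have hμt (l : ι) : μ t l = Real.exp (F l * t) * μ 0 l * Real.exp (-S) := by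
    rw [eq_exp_integral_smul (c := fun t => F l - ∑ k, F k * μ t k) (continuous_const.sub hc)
      (hμ l) t, smul_eq_mul, intervalIntegral.integral_sub intervalIntegrable_const
      (hc.intervalIntegrable _ _), intervalIntegral.integral_const, sub_eq_add_neg, Real.exp_add,
      sub_zero, smul_eq_mul, mul_comm t]
    ring
  have hnorm : (∑ l, Real.exp (F l * t) * μ 0 l) * Real.exp (-S) = 1 := by
    rw [← hsum t, Finset.sum_mul]
    exact Finset.sum_congr rfl fun l _ => (hμt l).symm
  rw [eq_div_iff (left_ne_zero_of_mul_eq_one hnorm), hμt j, mul_assoc _ (Real.exp (-S)),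
    mul_comm (Real.exp (-S)), hnorm, mul_one]

theorem IsHamiltonianCurve.mass_eq [NeZero n] {f : ℂ[X]} {γ : ℝ → Mat n} {ϑ : Fin n → ℝ}
    (hγ : IsHamiltonianCurve (hamiltonian f) γ) (h₀ : γ 0 ∈ cmvSet n) (hϑ : IsSpectrum (γ 0) ϑ)
    (j : Fin n) (t : ℝ) :
    mass (γ t) (pt (ϑ j)) = Real.exp (bigF f (pt (ϑ j)) * t) * mass (γ 0) (pt (ϑ j)) /
      ∑ l, Real.exp (bigF f (pt (ϑ l)) * t) * mass (γ 0) (pt (ϑ l)) :=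
  eq_exp_mul_div_sum_of_sum_eq_one (μ := fun s k => mass (γ s) (pt (ϑ k)))
    (F := fun k => bigF f (pt (ϑ k)))
    (fun s => (hγ.isSpectrum h₀ hϑ s).sum_mass
      (mem_cmvSet_iff.1 (hγ.mem_cmvSet (continuous_grad_hamiltonian f) h₀ s)).1)
    (fun k s => hγ.hasDerivAt_mass h₀ hϑ k s) t j

theorem contDiff_hamVec {k : WithTop ℕ∞} {Y : Mat n → Mat n} (hY : ContDiff ℝ k Y) :
    ContDiff ℝ k fun B => hamVec (Y B) B :=
  (contDiff_matrix_mul (contDiff_piA.comp (contDiff_matrix_mul contDiff_id hY)) contDiff_id).sub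
    (contDiff_matrix_mul contDiff_id (contDiff_piA.comp (contDiff_matrix_mul hY contDiff_id)))

theorem hamVec_zero (B : Mat n) : hamVec 0 B = 0 := by
  have h : piA (0 : Mat n) = 0 := (piALin n).map_zero
  simp [hamVec, h]

theorem exists_isIntegralCurve_hamVec {Y : Mat n → Mat n} (hY : ContDiff ℝ 1 Y) {C : Mat n}
    (hC : C ∈ Matrix.unitaryGroup (Fin n) ℂ) :
    ∃ γ : ℝ → Mat n, γ 0 = C ∧ IsIntegralCurve γ fun _ B => hamVec (Y B) B := by
  -- Multiplying `Y` by a bump function makes the field complete and keeps the unitary group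
  -- invariant; the bump function is `1` there, because the entries of unitaries are at most `1`.
  let χ : ContDiffBump (0 : Mat n) := ⟨1, 2, one_pos, one_lt_two⟩
  have hχY : ContDiff ℝ 1 fun B => χ B • Y B := χ.contDiff.smul hY
  have hsupp : HasCompactSupport fun B => hamVec (χ B • Y B) B := by
    refine χ.hasCompactSupport.mono fun B => mt fun h => ?_
    simp only [h, zero_smul, hamVec_zero]
  obtain ⟨γ, h₀, hγ⟩ :=
    exists_isIntegralCurve_of_hasCompactSupport (contDiff_hamVec hχY) hsupp C
  refine ⟨γ, h₀, fun t => (hγ t).congr_deriv ?_⟩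
  have hu := mem_unitaryGroup_of_hamVec (X := fun t => χ (γ t) • Y (γ t))
    (hχY.continuous.comp hγ.continuous) (fun s => hγ s) (h₀ ▸ hC) t
  have hχ : χ (γ t) = 1 := χ.one_of_mem_closedBall <|
    mem_closedBall_zero_iff.2 (entrywise_sup_norm_bound_of_unitary hu)
  simp only [hχ, one_smul]

theorem exists_curve_mem_cmvSet [NeZero n] {C : Mat n} (hC : C ∈ cmvSet n) (X : Mat n) :
    ∃ γ : ℝ → Mat n, γ 0 = C ∧ (∀ t, γ t ∈ cmvSet n) ∧ HasDerivAt γ (hamVec X C) 0 := by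
  obtain ⟨γ, rfl, hγ⟩ := exists_isIntegralCurve_hamVec (Y := fun _ => X) contDiff_const
    (mem_cmvSet_iff.1 hC).1
  exact ⟨γ, rfl, mem_cmvSet_of_hamVec (X := fun _ => X) continuous_const hγ hC, hγ 0⟩

section Restriction

variable {C V : Mat n} {φ ψ Φ Ψ : Mat n → ℝ} {γ : ℝ → Mat n} {t : ℝ}

theorem tendsto_nhdsWithin_cmvSet (hγ : ContinuousAt γ t) (hmem : ∀ s, γ s ∈ cmvSet n) :
    Filter.Tendsto γ (𝓝 t) (𝓝[cmvSet n] γ t) :=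
  tendsto_nhdsWithin_iff.2 ⟨hγ, .of_forall hmem⟩

theorem IsExtension.hasDerivAt (hΨ : IsExtension (γ t) ψ Ψ) (hmem : ∀ s, γ s ∈ cmvSet n)
    (hγ : HasDerivAt γ V t) : HasDerivAt (fun s => ψ (γ s)) (fderiv ℝ Ψ (γ t) V) t :=
  ((hΨ.1.differentiableAt (by simp)).hasFDerivAt.comp_hasDerivAt t hγ).congr_of_eventuallyEq <|
    (tendsto_nhdsWithin_cmvSet hγ.continuousAt hmem).eventually
      (hΨ.2.mono fun _ h => h.symm)

variable [NeZero n]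

theorem IsExtension.fderiv_hamVec_eq {Ψ' : Mat n → ℝ} (hC : C ∈ cmvSet n)
    (hΨ : IsExtension C ψ Ψ) (hΨ' : IsExtension C ψ Ψ') (X : Mat n) :
    fderiv ℝ Ψ C (hamVec X C) = fderiv ℝ Ψ' C (hamVec X C) := by
  obtain ⟨γ, rfl, hmem, hγ⟩ := exists_curve_mem_cmvSet hC X
  exact (hΨ.hasDerivAt hmem hγ).unique (hΨ'.hasDerivAt hmem hγ)

theorem hasBracketAt_of_isExtension (hC : C ∈ cmvSet n) (hΦ : IsExtension C φ Φ)
    (hΨ : IsExtension C ψ Ψ) : HasBracketAt φ ψ (gdBracket Φ Ψ C) C := by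
  refine ⟨⟨Φ, hΦ⟩, ⟨Ψ, hΨ⟩, fun Φ' Ψ' hΦ' hΨ' => ?_⟩
  calc gdBracket Φ' Ψ' C = gdBracket Φ' Ψ C := by
        rw [gdBracket_eq_fderiv, gdBracket_eq_fderiv, hΨ'.fderiv_hamVec_eq hC hΨ]
    _ = gdBracket Φ Ψ C := by
        rw [gdBracket_antisymm, gdBracket_antisymm Φ, gdBracket_eq_fderiv, gdBracket_eq_fderiv,
          hΦ'.fderiv_hamVec_eq hC hΦ]

end Restriction

section Angles

theorem contDiff_pt {k : WithTop ℕ∞} : ContDiff ℝ k pt :=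
  (Complex.ofRealCLM.contDiff.mul contDiff_const).cexp

theorem hasDerivAt_pt (x : ℝ) : HasDerivAt pt (pt x * Complex.I) x := by
  simpa [pt] using! (((hasDerivAt_id x).ofReal_comp).mul_const Complex.I).cexp

theorem pt_add (x y : ℝ) : pt (x + y) = pt x * pt y := by
  simp [pt, add_mul, Complex.exp_add]

theorem eq_of_pt_eq {x y : ℝ} (h : pt x = pt y) (hxy : |x - y| < Real.pi) : x = y := by
  have h₁ : pt (x - y) = pt 0 := mul_right_cancel₀ (pt_ne_zero y) <| by
    rw [← pt_add, ← pt_add, sub_add_cancel, zero_add, h]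
  have harg (r : ℝ) (hr : |r| < Real.pi) : (pt r).arg = r :=
    Complex.arg_exp_mul_I r ▸ (toIocMod_eq_self _).2 (by grind [abs_lt])
  rw [← sub_eq_zero, ← harg _ hxy, h₁, harg 0 (by simpa using Real.pi_pos)]

theorem IsSpectrum.eventuallyEq {X : Type*} {l : Filter X} {B : X → Mat n}
    {θ θ' : X → Fin n → ℝ} {ϑ : Fin n → ℝ} (hϑ : Function.Injective fun j => pt (ϑ j))
    (hB : ∀ᶠ x in l, B x ∈ Matrix.unitaryGroup (Fin n) ℂ)
    (hθ : ∀ᶠ x in l, IsSpectrum (B x) (θ x)) (hθ' : ∀ᶠ x in l, IsSpectrum (B x) (θ' x))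
    (hlim : Filter.Tendsto θ l (𝓝 ϑ)) (hlim' : Filter.Tendsto θ' l (𝓝 ϑ)) : θ =ᶠ[l] θ' := by
  have hpt {η : X → Fin n → ℝ} (hη : Filter.Tendsto η l (𝓝 ϑ)) (j : Fin n) :
      Filter.Tendsto (fun x => pt (η x j)) l (𝓝 (pt (ϑ j))) :=
    (contDiff_pt (k := 0)).continuous.continuousAt.tendsto.comp (tendsto_pi_nhds.1 hη j)
  have hne : ∀ᶠ x in l, ∀ j k, j ≠ k → pt (θ x j) ≠ pt (θ' x k) := by
    simp only [Filter.eventually_all]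
    exact fun j k hjk => (((hpt hlim j).sub (hpt hlim' k)).eventually_ne
      (sub_ne_zero.2 (hϑ.ne hjk))).mono fun _ => sub_ne_zero.1
  have hclose : ∀ᶠ x in l, ∀ j, |θ x j - θ' x j| < Real.pi := by
    rw [Filter.eventually_all]
    intro j
    have h := ((tendsto_pi_nhds.1 hlim j).sub (tendsto_pi_nhds.1 hlim' j)).abs
    rw [sub_self, abs_zero] at h
    exact h.eventually_lt_const Real.pi_pos
  filter_upwards [hB, hθ, hθ', hne, hclose] with x hBx hx hx' hnex hclosex
  funext j
  obtain ⟨k, hk⟩ := hx'.exists_eq_pt hBx (hx.2 j)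
  have hjk : j = k := by_contra fun h => hnex j k h hk
  exact eq_of_pt_eq (hjk ▸ hk) (hclosex j)

end Angles

section SmoothSpectrum

variable {E : Type*} [NormedAddCommGroup E] [NormedSpace ℝ E] {k : WithTop ℕ∞} {x : E}

theorem exists_contDiffAt_implicit [CompleteSpace E] {g : E × ℂ → ℂ} {z d : ℂ}
    (hg : ContDiffAt ℝ k g (x, z)) (hk : k ≠ 0)
    (hd : HasDerivAt (fun w => g (x, w)) d z) (hd₀ : d ≠ 0) :
    ∃ ζ : E → ℂ, ContDiffAt ℝ k ζ x ∧ ζ x = z ∧ ∀ᶠ y in 𝓝 x, g (y, ζ y) = g (x, z) := by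
  have hpartial : fderiv ℝ g (x, z) ∘L .inr ℝ E ℂ =
      (ContinuousLinearEquiv.unitsEquivAut ℂ (Units.mk0 d hd₀)).restrictScalars ℝ := by
    refine ((hg.differentiableAt hk).hasFDerivAt.comp z (hasFDerivAt_prodMk_right x z)).unique ?_
    exact hd.hasFDerivAt.restrictScalars ℝ
  have hinv : (fderiv ℝ g (x, z) ∘L .inr ℝ E ℂ).IsInvertible := ⟨_, hpartial.symm⟩
  exact ⟨_, hg.contDiffAt_implicitFunction hk hinv, hg.implicitFunction_apply_self hk hinv,
    hg.eventually_apply_implicitFunction hk hinv⟩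

theorem contDiff_det_smul_one_sub :
    ContDiff ℝ k fun p : Mat n × ℂ => (p.2 • (1 : Mat n) - p.1).det :=
  contDiff_iff_contDiffAt.2 fun _ => contDiffAt_det <| ContDiffAt.sub
    (contDiffAt_matrix.2 fun _ _ => contDiffAt_snd.mul contDiffAt_const) contDiffAt_fst

theorem IsSpectrum.hasDerivAt_det_smul_one_sub {B : Mat n} {ϑ : Fin n → ℝ}
    (hϑ : IsSpectrum B ϑ) (hB : B ∈ Matrix.unitaryGroup (Fin n) ℂ) (j : Fin n) :
    HasDerivAt (fun w : ℂ => (w • (1 : Mat n) - B).det)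
      (∏ k ∈ Finset.univ.erase j, (pt (ϑ j) - pt (ϑ k))) (pt (ϑ j)) := by
  have h : (fun w : ℂ => (w • (1 : Mat n) - B).det) =
      fun w => (Lagrange.nodal Finset.univ fun k => pt (ϑ k)).eval w :=
    funext fun w => by rw [hϑ.det_smul_one_sub hB, Lagrange.eval_nodal]
  rw [h, ← Lagrange.eval_nodal, ← Lagrange.eval_nodal_derivative_eval_node_eq
    (v := fun k => pt (ϑ k)) (Finset.mem_univ j)]
  exact Polynomial.hasDerivAt _ _

theorem IsSpectrum.exists_contDiffAt_eigenvalue {B : Mat n} {ϑ : Fin n → ℝ}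
    (hϑ : IsSpectrum B ϑ) (hB : B ∈ Matrix.unitaryGroup (Fin n) ℂ) (j : Fin n) :
    ∃ ζ : Mat n → ℂ, ContDiffAt ℝ ∞ ζ B ∧ ζ B = pt (ϑ j) ∧
      ∀ᶠ A in 𝓝 B, Module.End.HasEigenvalue (Matrix.toEuclideanLin A) (ζ A) := by
  have hd₀ : ∏ k ∈ Finset.univ.erase j, (pt (ϑ j) - pt (ϑ k)) ≠ 0 :=
    Finset.prod_ne_zero_iff.2 fun _ hk => sub_ne_zero.2 (hϑ.1.ne (Finset.ne_of_mem_erase hk).symm)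
  have hdet := hasEigenvalue_iff_det.1 (hϑ.2 j)
  obtain ⟨ζ, hζ, hζB, hζ₀⟩ := exists_contDiffAt_implicit (k := ∞) (x := B)
    contDiff_det_smul_one_sub.contDiffAt (by simp) (hϑ.hasDerivAt_det_smul_one_sub hB j) hd₀
  exact ⟨ζ, hζ, hζB, hζ₀.mono fun A hA => hasEigenvalue_iff_det.2 (hA.trans hdet)⟩

theorem contDiffAt_aeval_lagrangeBasis {A : E → Mat n} {z : E → Fin n → ℂ}
    (hA : ContDiffAt ℝ k A x) (hz : ∀ i, ContDiffAt ℝ k (fun y => z y i) x)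
    (hinj : Function.Injective (z x)) (j : Fin n) :
    ContDiffAt ℝ k (fun y => aeval (A y) (Lagrange.basis Finset.univ (z y) j)) x := by
  have h (s : Finset (Fin n)) (hs : j ∉ s) :
      ContDiffAt ℝ k (fun y => aeval (A y) (∏ i ∈ s, Lagrange.basisDivisor (z y j) (z y i))) x := by
    induction s using Finset.induction_on with
    | empty => simpa using contDiffAt_const
    | insert i s hi ih =>
      rw [Finset.mem_insert, not_or] at hs
      simp only [Finset.prod_insert hi, map_mul]
      refine contDiffAt_matrix_mul ?_ (ih hs.2)
      simp only [Lagrange.basisDivisor, map_mul, map_sub, aeval_C, aeval_X,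
        Algebra.algebraMap_eq_smul_one, smul_mul_assoc, one_mul]
      refine contDiffAt_matrix.2 fun a b => ?_
      exact (((hz j).sub (hz i)).inv (sub_ne_zero.2 (hinj.ne hs.1))).mul
        ((contDiffAt_matrix.1 hA a b).sub ((hz i).mul contDiffAt_const))
  exact h _ (Finset.notMem_erase j _)

end SmoothSpectrum

theorem IsSpectrum.exists_contDiffAt_angles {B : Mat n} {ϑ : Fin n → ℝ} (hϑ : IsSpectrum B ϑ)
    (hB : B ∈ Matrix.unitaryGroup (Fin n) ℂ) :
    ∃ Θ : Mat n → Fin n → ℝ, (∀ j, ContDiffAt ℝ ∞ (fun A => Θ A j) B) ∧ Θ B = ϑ ∧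
      ∀ᶠ A in 𝓝[(Matrix.unitaryGroup (Fin n) ℂ : Set (Mat n))] B, IsSpectrum A (Θ A) := by
  choose ζ hζ hζB hζA using fun j => hϑ.exists_contDiffAt_eigenvalue hB j
  have hone (j : Fin n) : ζ j B / pt (ϑ j) = 1 := by rw [hζB, div_self (pt_ne_zero _)]
  have hlog (j : Fin n) : ContDiffAt ℝ ∞ (fun A => Complex.log (ζ j A / pt (ϑ j))) B :=
    ((Complex.contDiffAt_log (hone j ▸ Complex.one_mem_slitPlane)).restrict_scalars ℝ).comp B
      ((hζ j).div_const _)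
  have hinj : ∀ᶠ A in 𝓝 B, Function.Injective fun j => ζ j A := by
    simp only [Function.Injective, Filter.eventually_all]
    intro i j
    rcases eq_or_ne i j with rfl | hij
    · exact .of_forall fun _ _ => rfl
    · refine (((hζ i).continuousAt.sub (hζ j).continuousAt).eventually_ne
        (sub_ne_zero.2 ?_)).mono fun _ hne heq => absurd heq (sub_ne_zero.1 hne)
      rw [hζB, hζB]
      exact hϑ.1.ne hij
  refine ⟨fun A j => ϑ j + (Complex.log (ζ j A / pt (ϑ j))).im,
    fun j => contDiffAt_const.add (Complex.imCLM.contDiff.contDiffAt.comp B (hlog j)),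
    funext fun j => by simp [hone], ?_⟩
  filter_upwards [self_mem_nhdsWithin, nhdsWithin_le_nhds hinj,
    nhdsWithin_le_nhds (Filter.eventually_all.2 hζA)] with A hA hinjA hζA
  have hpt (j : Fin n) : pt (ϑ j + (Complex.log (ζ j A / pt (ϑ j))).im) = ζ j A := by
    obtain ⟨v, hv₀, hv⟩ := hasEigenvalue_iff.1 (hζA j)
    rw [pt_add, Complex.log_im, pt_arg, mul_div_cancel₀ _ (pt_ne_zero _)]
    rw [norm_div, norm_pt, norm_eq_one_of_mulVec hA hv₀ hv, div_one]
  exact ⟨by simpa only [hpt] using hinjA, fun j => hpt j ▸ hζA j⟩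

section Labelling

variable [NeZero n] {C : Mat n} {θ : Mat n → Fin n → ℝ} {ϑ : Fin n → ℝ}

theorem eventually_mem_unitaryGroup_nhdsWithin_cmvSet :
    ∀ᶠ B in 𝓝[cmvSet n] C, B ∈ Matrix.unitaryGroup (Fin n) ℂ :=
  eventually_mem_nhdsWithin.mono fun _ hB => (mem_cmvSet_iff.1 hB).1

theorem exists_isLabelling (hC : C ∈ cmvSet n) (hϑ : IsSpectrum C ϑ) :
    ∃ Θ, IsLabelling C Θ ∧ Θ C = ϑ ∧ ∀ j, ContDiffAt ℝ ∞ (fun B => Θ B j) C := by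
  obtain ⟨Θ, hΘ, hΘC, hsp⟩ := hϑ.exists_contDiffAt_angles (mem_cmvSet_iff.1 hC).1
  exact ⟨Θ, ⟨hsp.filter_mono (nhdsWithin_mono C fun B hB => (mem_cmvSet_iff.1 hB).1),
    (continuousAt_pi.2 fun j => (hΘ j).continuousAt).continuousWithinAt⟩, hΘC, hΘ⟩

omit [NeZero n] in
theorem IsLabelling.isSpectrum (hθ : IsLabelling C θ) (hC : C ∈ cmvSet n) : IsSpectrum C (θ C) :=
  hθ.1.self_of_nhdsWithin hC

theorem IsLabelling.exists_contDiffAt_eventuallyEq (hθ : IsLabelling C θ) (hC : C ∈ cmvSet n) :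
    ∃ Θ : Mat n → Fin n → ℝ, (∀ j, ContDiffAt ℝ ∞ (fun B => Θ B j) C) ∧ Θ C = θ C ∧
      Θ =ᶠ[𝓝[cmvSet n] C] θ := by
  obtain ⟨Θ, hΘ, hΘC, hsmooth⟩ := exists_isLabelling hC (hθ.isSpectrum hC)
  exact ⟨Θ, hsmooth, hΘC, IsSpectrum.eventuallyEq (hθ.isSpectrum hC).1
    eventually_mem_unitaryGroup_nhdsWithin_cmvSet hΘ.1 hθ.1 (hΘC ▸ hΘ.2) hθ.2⟩

theorem IsLabelling.exists_isExtension (hθ : IsLabelling C θ) (hC : C ∈ cmvSet n) (j : Fin n) :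
    ∃ Θ, IsExtension C (fun B => θ B j) Θ := by
  obtain ⟨Θ, hΘ, -, heq⟩ := hθ.exists_contDiffAt_eventuallyEq hC
  exact ⟨_, hΘ j, heq.mono fun B hB => congrFun hB j⟩

theorem IsLabelling.exists_isExtension_log_mass (hθ : IsLabelling C θ) (hC : C ∈ cmvSet n)
    (j : Fin n) : ∃ Ψ, IsExtension C (fun B => Real.log (mass B (pt (θ B j)))) Ψ := by
  obtain ⟨Θ, hΘ, hΘC, heq⟩ := hθ.exists_contDiffAt_eventuallyEq hC
  have hsp := hθ.isSpectrum hC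
  have hsmooth := contDiffAt_aeval_lagrangeBasis (z := fun B k => pt (Θ B k)) contDiffAt_id
    (fun i => contDiff_pt.contDiffAt.comp C (hΘ i)) (by simpa only [hΘC] using hsp.1) j
  refine ⟨fun B => Real.log (aeval B (Lagrange.basis .univ (fun k => pt (Θ B k)) j) 0 0).re,
    (Complex.reCLM.contDiff.contDiffAt.comp C (contDiffAt_matrix.1 hsmooth 0 0)).log ?_, ?_⟩
  · change (aeval C (Lagrange.basis .univ (fun k => pt (Θ C k)) j) 0 0).re ≠ 0
    rw [hΘC, hsp.re_aeval_lagrangeBasis_apply_zero_zero (mem_cmvSet_iff.1 hC).1]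
    exact (mass_pos hC hsp j).ne'
  · filter_upwards [eventually_mem_unitaryGroup_nhdsWithin_cmvSet, hθ.1, heq] with B hB hspB hΘB
    rw [hΘB, hspB.re_aeval_lagrangeBasis_apply_zero_zero hB]

theorem IsLabelling.exists_isExtension_half_log_mass_div (hθ : IsLabelling C θ)
    (hC : C ∈ cmvSet n) (j m : Fin n) :
    ∃ Ψ, IsExtension C
      (fun B => (1 / 2) * Real.log (mass B (pt (θ B j)) / mass B (pt (θ B m)))) Ψ := by
  obtain ⟨Ψ, hΨ⟩ := hθ.exists_isExtension_log_mass hC j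
  obtain ⟨Ψ', hΨ'⟩ := hθ.exists_isExtension_log_mass hC m
  refine ⟨fun B => 1 / 2 * (Ψ B - Ψ' B), contDiffAt_const.mul (hΨ.1.sub hΨ'.1), ?_⟩
  filter_upwards [hΨ.2, hΨ'.2, hθ.1, eventually_mem_nhdsWithin] with B h h' hsp hB
  rw [h, h', Real.log_div (mass_pos hB hsp j).ne' (mass_pos hB hsp m).ne']

end Labelling

section Brackets

variable [NeZero n] {C : Mat n} {θ : Mat n → Fin n → ℝ} {f : ℂ[X]} {γ : ℝ → Mat n}

omit [NeZero n] in
theorem isExtension_hamiltonian (f : ℂ[X]) (C : Mat n) :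
    IsExtension C (hamiltonian f) (hamiltonian f) :=
  ⟨(contDiff_hamiltonian f).contDiffAt, .rfl⟩

theorem exists_isHamiltonianCurve (hC : C ∈ cmvSet n) (f : ℂ[X]) :
    ∃ γ, IsHamiltonianCurve (hamiltonian f) γ ∧ γ 0 = C := by
  obtain ⟨γ, h₀, hγ⟩ := exists_isIntegralCurve_hamVec (contDiff_aeval f.derivative)
    (mem_cmvSet_iff.1 hC).1
  refine ⟨γ, isHamiltonianCurve_iff.2 ?_, h₀⟩
  simpa only [grad_hamiltonian] using hγ

theorem IsHamiltonianCurve.gdBracket_eq {ψ Ψ : Mat n → ℝ} {v : ℝ}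
    (hγ : IsHamiltonianCurve (hamiltonian f) γ) (h₀ : γ 0 ∈ cmvSet n)
    (hΨ : IsExtension (γ 0) ψ Ψ) (hψ : HasDerivAt (fun t => ψ (γ t)) v 0) :
    gdBracket (hamiltonian f) Ψ (γ 0) = v := by
  rw [gdBracket_eq_fderiv]
  exact (hΨ.hasDerivAt (hγ.mem_cmvSet (continuous_grad_hamiltonian f) h₀)
    (isHamiltonianCurve_iff.1 hγ 0)).unique hψ

theorem IsLabelling.eventuallyEq_of_isHamiltonianCurve (hθ : IsLabelling (γ 0) θ)
    (hγ : IsHamiltonianCurve (hamiltonian f) γ) (h₀ : γ 0 ∈ cmvSet n) :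
    ∀ᶠ t in 𝓝 0, θ (γ t) = θ (γ 0) := by
  have hmem := hγ.mem_cmvSet (continuous_grad_hamiltonian f) h₀
  have hlim : Filter.Tendsto γ (𝓝 0) (𝓝[cmvSet n] γ 0) :=
    tendsto_nhdsWithin_cmvSet (isHamiltonianCurve_iff.1 hγ).continuous.continuousAt hmem
  have hsp := hθ.isSpectrum h₀
  exact IsSpectrum.eventuallyEq hsp.1 (.of_forall fun t => (mem_cmvSet_iff.1 (hmem t)).1)
    (hlim.eventually hθ.1) (.of_forall (hγ.isSpectrum h₀ hsp)) (hθ.2.tendsto.comp hlim)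
    tendsto_const_nhds

theorem IsLabelling.hasDerivAt_log_mass (hθ : IsLabelling (γ 0) θ)
    (hγ : IsHamiltonianCurve (hamiltonian f) γ) (h₀ : γ 0 ∈ cmvSet n) (j : Fin n) :
    HasDerivAt (fun t => Real.log (mass (γ t) (pt (θ (γ t) j))))
      (bigF f (pt (θ (γ 0) j)) -
        ∑ l, bigF f (pt (θ (γ 0) l)) * mass (γ 0) (pt (θ (γ 0) l))) 0 := by
  refine (hγ.hasDerivAt_log_mass h₀ (hθ.isSpectrum h₀) j 0).congr_of_eventuallyEq ?_
  filter_upwards [hθ.eventuallyEq_of_isHamiltonianCurve hγ h₀] with t ht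
  rw [ht]

theorem hasBracketAt_hamiltonian_log_mass (hC : C ∈ cmvSet n) (hθ : IsLabelling C θ) (f : ℂ[X])
    (j : Fin n) :
    HasBracketAt (hamiltonian f) (fun B => Real.log (mass B (pt (θ B j))))
      (bigF f (pt (θ C j)) - ∑ l, bigF f (pt (θ C l)) * mass C (pt (θ C l))) C := by
  obtain ⟨γ, hγ, rfl⟩ := exists_isHamiltonianCurve hC f
  obtain ⟨Ψ, hΨ⟩ := hθ.exists_isExtension_log_mass hC j
  rw [← hγ.gdBracket_eq hC hΨ (hθ.hasDerivAt_log_mass hγ hC j)]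
  exact hasBracketAt_of_isExtension hC (isExtension_hamiltonian f _) hΨ

theorem gdBracket_hamiltonian_half_log_mass_div (hC : C ∈ cmvSet n) (hθ : IsLabelling C θ)
    {j m : Fin n} {Ψ : Mat n → ℝ}
    (hΨ : IsExtension C
      (fun B => (1 / 2) * Real.log (mass B (pt (θ B j)) / mass B (pt (θ B m)))) Ψ) :
    gdBracket (hamiltonian f) Ψ C =
      1 / 2 * (bigF f (pt (θ C j)) - bigF f (pt (θ C m))) := by
  obtain ⟨γ, hγ, rfl⟩ := exists_isHamiltonianCurve hC f
  have hmem := hγ.mem_cmvSet (continuous_grad_hamiltonian f) hC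
  refine hγ.gdBracket_eq hC hΨ ?_
  refine (((hθ.hasDerivAt_log_mass hγ hC j).sub (hθ.hasDerivAt_log_mass hγ hC m)).const_mul
    (1 / 2)).congr_of_eventuallyEq ?_ |>.congr_deriv (by ring)
  filter_upwards [hθ.eventuallyEq_of_isHamiltonianCurve hγ hC] with t ht
  have hpos := mass_pos (hmem t) (hγ.isSpectrum hC (hθ.isSpectrum hC) t)
  simp only [ht, Pi.sub_apply]
  rw [Real.log_div (hpos j).ne' (hpos m).ne']

theorem exists_derivative_eq {K : Type*} [Field K] [CharZero K] (g : K[X]) :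
    ∃ f : K[X], derivative f = g := by
  induction g using Polynomial.induction_on' with
  | add p q hp hq =>
    obtain ⟨f, rfl⟩ := hp
    obtain ⟨g, rfl⟩ := hq
    exact ⟨f + g, derivative_add⟩
  | monomial m a =>
    refine ⟨monomial (m + 1) (a / (m + 1)), ?_⟩
    rw [derivative_monomial]
    push_cast
    rw [div_mul_cancel₀ _ m.cast_add_one_ne_zero]

theorem exists_eval_derivative_eq {ι K : Type*} [Field K] [CharZero K] {s : Finset ι} {z : ι → K}
    (hz : Set.InjOn z s) (r : ι → K) : ∃ f : K[X], ∀ i ∈ s, (derivative f).eval (z i) = r i := by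
  classical
  obtain ⟨f, hf⟩ := exists_derivative_eq (Lagrange.interpolate s z r)
  exact ⟨f, fun i hi => hf ▸ Lagrange.eval_interpolate_at_node r hz hi⟩

theorem hasDerivAt_im_eval_pt (f : ℂ[X]) {u : ℝ → ℝ} {u' t : ℝ} (hu : HasDerivAt u u' t) :
    HasDerivAt (fun s => (f.eval (pt (u s))).im)
      ((pt (u t) * f.derivative.eval (pt (u t))).re * u') t := by
  have h := (f.hasDerivAt (pt (u t))).comp_of_eq t ((hasDerivAt_pt (u t)).scomp t hu) rfl
  refine (Complex.imCLM.hasFDerivAt.comp_hasDerivAt t h).congr_deriv ?_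
  simp only [Complex.real_smul, Complex.imCLM_apply, Complex.mul_im, Complex.mul_re,
    Complex.ofReal_re, Complex.ofReal_im, Complex.I_re, Complex.I_im]
  ring

theorem fderiv_hamiltonian_hamVec {Θ : Fin n → Mat n → ℝ} (hC : C ∈ cmvSet n)
    (hθ : IsLabelling C θ) (hΘ : ∀ k, IsExtension C (fun B => θ B k) (Θ k)) (f : ℂ[X])
    (V : Mat n) :
    fderiv ℝ (hamiltonian f) C (hamVec V C) =
      ∑ k, (pt (θ C k) * f.derivative.eval (pt (θ C k))).re * fderiv ℝ (Θ k) C (hamVec V C) := by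
  obtain ⟨γ, rfl, hmem, hγ⟩ := exists_curve_mem_cmvSet hC V
  refine ((isExtension_hamiltonian f _).hasDerivAt hmem hγ).unique ?_
  refine (HasDerivAt.fun_sum fun k _ =>
    hasDerivAt_im_eval_pt f ((hΘ k).hasDerivAt hmem hγ)).congr_of_eventuallyEq ?_
  filter_upwards [(tendsto_nhdsWithin_cmvSet hγ.continuousAt hmem).eventually hθ.1] with t ht
  rw [hamiltonian, ht.trace_aeval (mem_cmvSet_iff.1 (hmem t)).1, Complex.im_sum]

theorem hasBracketAt_angle_log_mass (hC : C ∈ cmvSet n) (hθ : IsLabelling C θ) {j l m : Fin n}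
    (hlm : l ≠ m) :
    HasBracketAt (fun B => θ B l)
      (fun B => (1 / 2) * Real.log (mass B (pt (θ B j)) / mass B (pt (θ B m))))
      (if j = l then 1 else 0) C := by
  choose Θ hΘ using hθ.exists_isExtension hC
  obtain ⟨Ψ, hΨ⟩ := hθ.exists_isExtension_half_log_mass_div hC j m
  obtain ⟨f, hf⟩ := exists_eval_derivative_eq (s := Finset.univ) (hθ.isSpectrum hC).1.injOn
    fun k => if k = l then (pt (θ C k))⁻¹ else 0
  have hfz (k : Fin n) :
      pt (θ C k) * f.derivative.eval (pt (θ C k)) = if k = l then 1 else 0 := by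
    rw [hf k (Finset.mem_univ k)]
    split_ifs <;> simp [pt_ne_zero]
  have hbracket : gdBracket (Θ l) Ψ C = if j = l then 1 else 0 := by
    calc gdBracket (Θ l) Ψ C = -fderiv ℝ (Θ l) C (hamVec (grad Ψ C) C) := by
          rw [gdBracket_antisymm, gdBracket_eq_fderiv]
      _ = -fderiv ℝ (hamiltonian f) C (hamVec (grad Ψ C) C) := by
          rw [fderiv_hamiltonian_hamVec hC hθ hΘ]
          simp [hfz, apply_ite Complex.re]
      _ = gdBracket (hamiltonian f) Ψ C := by
          rw [gdBracket_antisymm (hamiltonian f), gdBracket_eq_fderiv]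
      _ = if j = l then 1 else 0 := by
          rw [gdBracket_hamiltonian_half_log_mass_div hC hθ hΨ]
          simp [bigF, hfz, hlm.symm, apply_ite Complex.re]
  exact hbracket ▸ hasBracketAt_of_isExtension hC (hΘ l) hΨ

end Brackets

end

end CMV

theorem corollaryC (n : ℕ) [NeZero n] (f : Polynomial ℂ) (C : CMV.Mat n)
    (hC : C ∈ CMV.cmvSet n) :
    -- the eigenvalue angles can be chosen continuously near `C`
    (∃ θ, CMV.IsLabelling C θ) ∧
    -- the Poisson brackets at `C`, for every such choice
    (∀ θ : CMV.Mat n → Fin n → ℝ, CMV.IsLabelling C θ →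
      (∀ j, CMV.HasBracketAt (CMV.hamiltonian f)
        (fun B => Real.log (CMV.mass B (CMV.pt (θ B j))))
        (CMV.bigF f (CMV.pt (θ C j))
          - ∑ l, CMV.bigF f (CMV.pt (θ C l)) * CMV.mass C (CMV.pt (θ C l))) C) ∧
      (∀ j l, j ≠ CMV.lastIdx n → l ≠ CMV.lastIdx n →
        CMV.HasBracketAt (fun B => θ B l)
          (fun B => (1 / 2) * Real.log (CMV.mass B (CMV.pt (θ B j))
            / CMV.mass B (CMV.pt (θ B (CMV.lastIdx n)))))
          (if j = l then 1 else 0) C)) ∧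
    -- the flow through `C` exists for all times
    (∃ γ : ℝ → CMV.Mat n, CMV.IsHamiltonianCurve (CMV.hamiltonian f) γ ∧ γ 0 = C) ∧
    -- it stays among the CMV matrices with the same spectrum, and moves the masses as claimed
    (∀ γ : ℝ → CMV.Mat n, CMV.IsHamiltonianCurve (CMV.hamiltonian f) γ → γ 0 = C →
      ∀ ϑ : Fin n → ℝ, CMV.IsSpectrum C ϑ → ∀ t : ℝ,
        γ t ∈ CMV.cmvSet n ∧ CMV.IsSpectrum (γ t) ϑ ∧
        ∀ j, 0 < CMV.mass (γ t) (CMV.pt (ϑ j)) ∧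
          HasDerivAt (fun s => Real.log (CMV.mass (γ s) (CMV.pt (ϑ j))))
            (CMV.bigF f (CMV.pt (ϑ j))
              - ∑ l, CMV.bigF f (CMV.pt (ϑ l)) * CMV.mass (γ t) (CMV.pt (ϑ l))) t ∧
          CMV.mass (γ t) (CMV.pt (ϑ j))
            = Real.exp (CMV.bigF f (CMV.pt (ϑ j)) * t) * CMV.mass C (CMV.pt (ϑ j))
              / ∑ l, Real.exp (CMV.bigF f (CMV.pt (ϑ l)) * t)
                  * CMV.mass C (CMV.pt (ϑ l))) := by
  refine ⟨?_, fun θ hθ => ⟨CMV.hasBracketAt_hamiltonian_log_mass hC hθ f,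
    fun j l _ hl => CMV.hasBracketAt_angle_log_mass hC hθ hl⟩,
    CMV.exists_isHamiltonianCurve hC f, fun γ hγ h₀ ϑ hϑ t => ?_⟩
  · obtain ⟨ϑ, hϑ⟩ := CMV.exists_isSpectrum hC
    obtain ⟨θ, hθ, -⟩ := CMV.exists_isLabelling hC hϑ
    exact ⟨θ, hθ⟩
  · subst h₀
    have hmem := hγ.mem_cmvSet (CMV.continuous_grad_hamiltonian f) hC t
    have hsp := hγ.isSpectrum hC hϑ t
    exact ⟨hmem, hsp, fun j =>
      ⟨CMV.mass_pos hmem hsp j, hγ.hasDerivAt_log_mass hC hϑ j t, hγ.mass_eq hC hϑ j t⟩⟩
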